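/- **Theorem 1.** Let $F_\varepsilon$ be a family of area-preserving maps of the real plane, depending on a real parameter $\varepsilon$, which is one of the following: (a) analytic, or (b) $C^\infty$: the map $(x,y,\varepsilon)\mapsto F_\varepsilon(x,y)\in\mathbb R^2$ is analytic, respectively $C^\infty$, jointly in all variables in a neighbourhood of the origin of $\mathbb R^3$, and $|\det DF_\varepsilon|=1$ there, where $D$ denotes the derivative with respect to $(x,y)$; (c) formal: the two components of $F_\varepsilon$ are formal power series in $(x,y,\varepsilon)$ with real coefficients and $\det DF_\varepsilon=\pm1$ as a formal series. Assume that $F_0(0)=0$, and that $DF_0(0)$ has the double eigenvalue $1$ and is not diagonalisable. In cases (a) and (b) denote the Taylor series of the family in $(x,y,\varepsilon)$ at the origin by $F_\varepsilon$ again. Then there are real coefficients $u_{km}$ and a formal canonical change of variables $\phi_\varepsilon$, possibly orientation-reversing, such that, as formal power series in $(x,y,\varepsilon)$, $$F_\varepsilon=\phi_\varepsilon^{-1}\circ\Phi^1_{h_\varepsilon}\circ\phi_\varepsilon,\qquad h_\varepsilon(x,y)=\frac{y^2}{2}+U_\varepsilon(x),\qquad U_\varepsilon(x)=\sum_{k,m\ge0,\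 k+3m\ge3}u_{km}\,x^k\varepsilon^m .$$ Here a formal canonical change of variables, possibly orientation-reversing, is a pair $\phi_\varepsilon$ of formal power series in $(x,y,\varepsilon)$ with real coefficients and $\phi_0(0)=0$, which is invertible under composition in $(x,y)$ (at the same $\varepsilon$) and satisfies $\det D\phi_\varepsilon=1$ or $\det D\phi_\varepsilon=-1$. The time-one map of a formal Hamiltonian $h_\varepsilon$ is the Lie series $$\Phi^1_{h_\varepsilon}(x,y)=\Bigl(\sum_{k\ge0}\tfrac1{k!}L^k_{h_\varepsilon}x,\ \sum_{k\ge0}\tfrac1{k!}L^k_{h_\varepsilon}y\Bigr),\qquad L_{h}g=\{g,h\}=\frac{\partial g}{\partial x}\frac{\partial h}{\partial y}-\frac{\partial g}{\partial y}\frac{\partial h}{\partial x},$$ where the sums converge formally, that is, every coefficient of the partial sums is eventually constant. -/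

import Mathlib

noncomputable section

/-- Formal power series in `x = X 0`, `y = X 1` and the parameter `ε = X 2`, real coefficients. -/
abbrev FormalSeries : Type := MvPowerSeries (Fin 3) ℝ

/-- A formal family of maps of the plane: two formal series (the components) in `x, y, ε`. -/
abbrev FormalFamily : Type := Fin 2 → FormalSeries

namespace FormalFamily

/-- The identity family `(x, y) ↦ (x, y)`. -/
def identity : FormalFamily := fun i => MvPowerSeries.X i.castSucc

/-- `F_0(0) = 0`: both components have zero constant coefficient. -/
def FixesOrigin (F : FormalFamily) : Prop :=
  ∀ i, MvPowerSeries.constantCoeff (F i) = 0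

/-- The composition `G_ε ∘ H_ε`, at the same parameter `ε`: substitute `H_ε` for `(x, y)` in `G_ε`.
It is used only for `H` with `FixesOrigin H`, for which the substitution is well defined. -/
def comp (G H : FormalFamily) : FormalFamily :=
  fun i => MvPowerSeries.subst ![H 0, H 1, MvPowerSeries.X 2] (G i)

/-- The Jacobian matrix `DF_ε` with respect to `(x, y)`. -/
def jacobian (F : FormalFamily) : Matrix (Fin 2) (Fin 2) FormalSeries :=
  Matrix.of fun i j => MvPowerSeries.pderiv ℝ j.castSucc (F i)

/-- The matrix `DF_0(0)`. -/
def linearPart (F : FormalFamily) : Matrix (Fin 2) (Fin 2) ℝ :=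
  F.jacobian.map MvPowerSeries.constantCoeff

/-- Area preservation, the orientation being preserved or reversed: `det DF_ε = ±1`. -/
def AreaPreserving (F : FormalFamily) : Prop :=
  F.jacobian.det = 1 ∨ F.jacobian.det = -1

/-- `φ` and `ψ` are mutually inverse formal changes of the variables `(x, y)`. -/
def MutuallyInverse (φ ψ : FormalFamily) : Prop :=
  φ.FixesOrigin ∧ ψ.FixesOrigin ∧ φ.comp ψ = identity ∧ ψ.comp φ = identity

end FormalFamily

/-- The Lie derivative `L_h g = {g, h} = ∂_x g ∂_y h - ∂_y g ∂_x h`. -/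
def lieDerivative (h g : FormalSeries) : FormalSeries :=
  MvPowerSeries.pderiv ℝ 0 g * MvPowerSeries.pderiv ℝ 1 h
    - MvPowerSeries.pderiv ℝ 1 g * MvPowerSeries.pderiv ℝ 0 h

/-- `Φ` is the time-one map of the formal Hamiltonian `h`: the Lie series
`exp(L_h) x = ∑ L_h^k x / k!` and `exp(L_h) y = ∑ L_h^k y / k!` converge formally (every
coefficient of the partial sums is eventually constant) to the components of `Φ`. -/
def IsTimeOneMap (h : FormalSeries) (Φ : FormalFamily) : Prop :=
  ∀ (i : Fin 2) (d : Fin 3 →₀ ℕ), ∀ᶠ N : ℕ in Filter.atTop,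
    MvPowerSeries.coeff d
      (∑ k ∈ Finset.range N, ((k.factorial : ℝ)⁻¹) • (lieDerivative h)^[k] (MvPowerSeries.X i.castSucc))
      = MvPowerSeries.coeff d (Φ i)

/-- The formal series `U_ε(x) = ∑_{k + 3m ≥ 3} u_{km} x^k ε^m`. -/
def potential (u : ℕ → ℕ → ℝ) : FormalSeries :=
  fun d => if d 1 = 0 ∧ 3 ≤ d 0 + 3 * d 2 then u (d 0) (d 2) else 0

/-- The Hamiltonian `h_ε(x, y) = y² / 2 + U_ε(x)`. -/
def normalFormHamiltonian (u : ℕ → ℕ → ℝ) : FormalSeries :=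
  MvPowerSeries.C (1 / 2 : ℝ) * MvPowerSeries.X 1 ^ 2 + potential u

/-- There are a formal canonical change of variables `φ_ε` (possibly reversing the orientation) and
coefficients `u_{km}` with `F_ε = φ_ε⁻¹ ∘ Φ¹_{h_ε} ∘ φ_ε` for the above Hamiltonian `h_ε`. -/
def HasSimplifiedNormalForm (F : FormalFamily) : Prop :=
  ∃ (φ ψ Φ : FormalFamily) (u : ℕ → ℕ → ℝ),
    φ.MutuallyInverse ψ ∧ φ.AreaPreserving ∧ Φ.FixesOrigin ∧
    IsTimeOneMap (normalFormHamiltonian u) Φ ∧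
    F = ψ.comp (Φ.comp φ)

/-- A real `2 × 2` matrix is diagonalisable: it is similar to a diagonal matrix. -/
def IsDiagonalisable (A : Matrix (Fin 2) (Fin 2) ℝ) : Prop :=
  ∃ (P : Matrix (Fin 2) (Fin 2) ℝ) (v : Fin 2 → ℝ), IsUnit P.det ∧ A * P = P * Matrix.diagonal v

/-- `1` is a double eigenvalue of `A`, and `A` is not diagonalisable. -/
def IsParabolic (A : Matrix (Fin 2) (Fin 2) ℝ) : Prop :=
  A.charpoly = (Polynomial.X - Polynomial.C 1) ^ 2 ∧ ¬ IsDiagonalisable A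

/-- The Jacobian matrix of a map of the plane. -/
def planeJacobian (f : (Fin 2 → ℝ) → (Fin 2 → ℝ)) (z : Fin 2 → ℝ) : Matrix (Fin 2) (Fin 2) ℝ :=
  LinearMap.toMatrix' (fderiv ℝ f z : (Fin 2 → ℝ) →ₗ[ℝ] (Fin 2 → ℝ))

/-- The coordinate directions of `x`, `y`, `ε` in the space of pairs `(ε, (x, y))`. -/
def coordDirection : Fin 3 → ℝ × (Fin 2 → ℝ) :=
  ![(0, Pi.single 0 1), (0, Pi.single 1 1), (1, 0)]

/-- The partial derivative of a function of `(ε, (x, y))` with respect to the `j`-th of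
`x`, `y`, `ε`. -/
def partialDerivative (j : Fin 3) (f : ℝ × (Fin 2 → ℝ) → ℝ) : ℝ × (Fin 2 → ℝ) → ℝ :=
  fun p => fderiv ℝ f p (coordDirection j)

/-- The Taylor series at the origin: the coefficient of `x^k y^l ε^m` is
`∂_x^k ∂_y^l ∂_ε^m f (0) / (k! l! m!)`. -/
def taylorSeriesAtOrigin (f : ℝ × (Fin 2 → ℝ) → ℝ) : FormalSeries :=
  fun d =>
    (partialDerivative 0)^[d 0] ((partialDerivative 1)^[d 1] ((partialDerivative 2)^[d 2] f)) 0
      / ((d 0).factorial * (d 1).factorial * (d 2).factorial : ℝ)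

/-- The Taylor series in `(x, y, ε)` of a family of maps `F_ε` of the plane. -/
def taylorFamily (F : ℝ → (Fin 2 → ℝ) → (Fin 2 → ℝ)) : FormalFamily :=
  fun i => taylorSeriesAtOrigin fun p => F p.1 p.2 i

end

/-! Give `x`, `y`, `ε` the weights 2, 3, 6. The Poisson bracket lowers weights by at most 5, so
`L_h` raises them by at least 1 once every monomial of `h` has weight at least 6, and then `exp L_h`
converges coefficient by coefficient. The condition k + 3m ≥ 3 means 2k + 6m ≥ 6: the admissible
potentials are exactly the `y`-independent series of weight at least 6.

A family is replaced by its pullback `S`, an algebra endomorphism of the series; determinant 1 means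
that `S` preserves the bracket. A linear change brings `DF_0(0)` to a Jordan block, after which `S`
is the identity plus terms that raise weights. Over the reals the determinant of this change can be
normalised only to ±1, which is why orientation may be reversed.

The conjugacy `S T = T exp(L_h)`, h = y²/2 + U, is built weight by weight. Suppose that the two
sides differ by terms of relative weight n + 2. Both preserve the bracket, so the leading part of
the difference is `L_g` with `g` of weight n + 7 (`exists_hamiltonian_of_isCanonical`). Replacing
`T` by `T exp(L_χ)` and `U` by `U + δ` turns `g` into g + L_h χ − δ (`expOp_mul_sub_mem_raising`).
This must vanish at weight n + 7 (`exists_homological`). Here L_h χ = y ∂_x χ − U' ∂_y χ: the first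
term can cancel every monomial divisible by `y`, and the second, though possibly of the same weight,
leaves a remainder of lower degree in `y`. Induction on that degree leaves a series in `x`, `ε`
alone, which `δ` absorbs. The corrections have growing weight, so the process has a limit
(`exists_conjugacy`).

For smooth families, Taylor expansion is compatible with sums, products and derivatives, and the
determinant is constant near the origin, so the formal case applies. -/

noncomputable section

/-! ### Weight filtrations and endomorphisms that respect them. -/

namespace FormalSeries

open MvPowerSeries

/-- The series with prescribed coefficients. -/
def ofCoeff (c : (Fin 3 →₀ ℕ) → ℝ) : FormalSeries := c

@[simp]
theorem coeff_ofCoeff (c : (Fin 3 →₀ ℕ) → ℝ) (d : Fin 3 →₀ ℕ) : coeff d (ofCoeff c) = c d := rfl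

/-- The weight of the monomial `x^k y^l ε^m` with exponent `d = (k, l, m)`. -/
def wt (w : Fin 3 → ℕ) (d : Fin 3 →₀ ℕ) : ℕ := w 0 * d 0 + w 1 * d 1 + w 2 * d 2

theorem wt_add (w : Fin 3 → ℕ) (d e : Fin 3 →₀ ℕ) : wt w (d + e) = wt w d + wt w e := by
  simp only [wt, Finsupp.add_apply]; ring

theorem wt_single (w : Fin 3 → ℕ) (i : Fin 3) (k : ℕ) : wt w (Finsupp.single i k) = w i * k := by
  fin_cases i <;> simp [wt]

theorem le_wt {w : Fin 3 → ℕ} (hw : ∀ i, 0 < w i) (d : Fin 3 →₀ ℕ) (i : Fin 3) : d i ≤ wt w d := by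
  have h (j : Fin 3) : d j ≤ w j * d j := Nat.le_mul_of_pos_left _ (hw j)
  have h0 := h 0
  have h1 := h 1
  have h2 := h 2
  fin_cases i <;> simp only [wt, Fin.zero_eta, Fin.mk_one, Fin.reduceFinMk] <;> omega

/-- The series all of whose monomials have weight at least `n`. -/
def filt (w : Fin 3 → ℕ) (n : ℕ) : Submodule ℝ FormalSeries where
  carrier := {f | ∀ d, wt w d < n → coeff d f = 0}
  add_mem' hf hg d hd := by simp [hf d hd, hg d hd]
  zero_mem' d _ := by simp
  smul_mem' c f hf d hd := by simp [hf d hd]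

theorem filt_mono {w : Fin 3 → ℕ} {m n : ℕ} (h : m ≤ n) {f : FormalSeries} (hf : f ∈ filt w n) :
    f ∈ filt w m := fun d hd => hf d (hd.trans_le h)

theorem mem_filt_zero {w : Fin 3 → ℕ} (f : FormalSeries) : f ∈ filt w 0 :=
  fun _ hd => absurd hd (Nat.not_lt_zero _)

theorem eq_zero_of_forall_mem_filt {w : Fin 3 → ℕ} {f : FormalSeries} (h : ∀ n, f ∈ filt w n) :
    f = 0 := by
  ext d
  exact h (wt w d + 1) d (Nat.lt_succ_self _)

theorem eq_of_forall_sub_mem_filt {w : Fin 3 → ℕ} {f g : FormalSeries}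
    (h : ∀ n, f - g ∈ filt w n) : f = g :=
  sub_eq_zero.1 (eq_zero_of_forall_mem_filt h)

theorem mul_mem_filt {w : Fin 3 → ℕ} {m n : ℕ} {f g : FormalSeries} (hf : f ∈ filt w m)
    (hg : g ∈ filt w n) : f * g ∈ filt w (m + n) := by
  intro d hd
  rw [coeff_mul]
  refine Finset.sum_eq_zero fun p hp => ?_
  rw [Finset.HasAntidiagonal.mem_antidiagonal] at hp
  rw [← hp, wt_add] at hd
  by_cases h : wt w p.1 < m
  · rw [hf _ h, zero_mul]
  · rw [hg p.2 (by omega), mul_zero]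

theorem pow_mem_filt {w : Fin 3 → ℕ} {m : ℕ} {f : FormalSeries} (hf : f ∈ filt w m) (k : ℕ) :
    f ^ k ∈ filt w (m * k) := by
  induction k with
  | zero => exact mem_filt_zero _
  | succ k ih => rw [pow_succ, Nat.mul_succ]; exact mul_mem_filt ih hf

theorem pderiv_mem_filt {w : Fin 3 → ℕ} {n k : ℕ} {i : Fin 3} (h : k ≤ n - w i)
    {f : FormalSeries} (hf : f ∈ filt w n) : pderiv ℝ i f ∈ filt w k := by
  intro d hd
  rw [coeff_pderiv, hf _ (by rw [wt_add, wt_single]; omega), zero_mul]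

theorem monomial_mem_filt {w : Fin 3 → ℕ} {n : ℕ} {d : Fin 3 →₀ ℕ} (h : n ≤ wt w d) (c : ℝ) :
    monomial d c ∈ filt w n := by
  intro e he
  rw [coeff_monomial, if_neg]
  rintro rfl
  omega

theorem X_mem_filt {w : Fin 3 → ℕ} (i : Fin 3) : (X i : FormalSeries) ∈ filt w (w i) :=
  monomial_mem_filt (by rw [wt_single, mul_one]) 1

/-- Every series is a polynomial up to terms of high weight. -/
theorem exists_sum_monomial_sub_mem_filt {w : Fin 3 → ℕ} (hw : ∀ i, 0 < w i) (f : FormalSeries)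
    (n : ℕ) : ∃ s : Finset (Fin 3 →₀ ℕ),
      f - ∑ d ∈ s, coeff d f • monomial d (1 : ℝ) ∈ filt w n := by
  refine ⟨Finset.Iic (Finsupp.equivFunOnFinite.symm fun _ => n), fun d hd => ?_⟩
  have hmem : d ∈ Finset.Iic (Finsupp.equivFunOnFinite.symm fun _ : Fin 3 => n) := by
    rw [Finset.mem_Iic]
    intro i
    exact (le_wt hw d i).trans hd.le
  rw [map_sub, map_sum, Finset.sum_eq_single d]
  · simp
  · intro e _ he
    simp [coeff_monomial, he.symm]
  · exact fun h => absurd hmem h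

/-- A linear map that lowers weights by at most `c` is controlled by its values at monomials. -/
theorem map_mem_filt_of_monomial {w : Fin 3 → ℕ} (hw : ∀ i, 0 < w i)
    {A : FormalSeries →ₗ[ℝ] FormalSeries} {c m n : ℕ}
    (hA : ∀ f ∈ filt w (m + c), A f ∈ filt w m)
    (hmon : ∀ d, n ≤ wt w d → A (monomial d 1) ∈ filt w m) {f : FormalSeries}
    (hf : f ∈ filt w n) : A f ∈ filt w m := by
  obtain ⟨s, hs⟩ := exists_sum_monomial_sub_mem_filt hw f (m + c)
  have h := (filt w m).add_mem (hA _ hs)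
    (Submodule.sum_mem (t := s) (f := fun d => coeff d f • A (monomial d 1)) _ fun d _ => ?_)
  · simpa [map_sub, map_sum] using h
  · by_cases hd : wt w d < n
    · simp [hf d hd]
    · exact Submodule.smul_mem _ _ (hmon d (not_lt.1 hd))

/-- A bounded loss of weight amounts to continuity for the weight topology, in which polynomials are
dense. -/
theorem linearMap_eq_of_monomial {w : Fin 3 → ℕ} (hw : ∀ i, 0 < w i)
    {A B : FormalSeries →ₗ[ℝ] FormalSeries} {c : ℕ}
    (hA : ∀ m, ∀ f ∈ filt w (m + c), A f ∈ filt w m)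
    (hB : ∀ m, ∀ f ∈ filt w (m + c), B f ∈ filt w m)
    (h : ∀ d, A (monomial d 1) = B (monomial d 1)) : A = B := by
  refine LinearMap.ext fun f => eq_of_forall_sub_mem_filt (w := w) fun m => ?_
  refine map_mem_filt_of_monomial (A := A - B) (c := c) (n := 0) hw
    (fun g hg => Submodule.sub_mem _ (hA m g hg) (hB m g hg)) (fun d _ => ?_) (mem_filt_zero f)
  simp [h d]

/-- A sequence of series that stabilises in every weight has a limit. -/
theorem exists_limit {w : Fin 3 → ℕ} (f : ℕ → FormalSeries)
    (h : ∀ n, f (n + 1) - f n ∈ filt w n) : ∃ g, ∀ n, g - f n ∈ filt w n := by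
  have hle : ∀ m n, m ≤ n → f n - f m ∈ filt w m := by
    intro m n hmn
    induction n, hmn using Nat.le_induction with
    | base => simp
    | succ n hn ih =>
      rw [← sub_add_sub_cancel]
      exact Submodule.add_mem _ (filt_mono hn (h n)) ih
  -- From index `wt w d + 1` on, the coefficient at `d` no longer changes.
  refine ⟨ofCoeff fun d => coeff d (f (wt w d + 1)), fun n d hd => ?_⟩
  have := hle (wt w d + 1) n hd d (Nat.lt_succ_self _)
  rw [map_sub, sub_eq_zero] at this ⊢
  rw [coeff_ofCoeff, this]

/-- An algebra endomorphism that fixes `ε` and does not lower weights. -/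
structure IsFiltered (w : Fin 3 → ℕ) (S : FormalSeries →ₐ[ℝ] FormalSeries) : Prop where
  map_eps : S (X 2) = X 2
  map_filt : ∀ {n : ℕ} {f : FormalSeries}, f ∈ filt w n → S f ∈ filt w n

theorem IsFiltered.comp {w : Fin 3 → ℕ} {S T : FormalSeries →ₐ[ℝ] FormalSeries}
    (hS : IsFiltered w S) (hT : IsFiltered w T) : IsFiltered w (S.comp T) :=
  ⟨by simp [hT.map_eps, hS.map_eps], fun hf => hS.map_filt (hT.map_filt hf)⟩

theorem monomial_eq_mul (d : Fin 3 →₀ ℕ) :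
    (monomial d (1 : ℝ)) = X 0 ^ d 0 * X 1 ^ d 1 * X 2 ^ d 2 := by
  rw [monomial_one_eq, Finsupp.prod_fintype _ _ (by simp), Fin.prod_univ_three]

/-- Two filtered endomorphisms that are close at `x` and `y` are close everywhere. -/
theorem IsFiltered.sub_mem_filt {w : Fin 3 → ℕ} (hw : ∀ i, 0 < w i)
    {S T : FormalSeries →ₐ[ℝ] FormalSeries} (hS : IsFiltered w S) (hT : IsFiltered w T) {k : ℕ}
    (h0 : S (X 0) - T (X 0) ∈ filt w (w 0 + k)) (h1 : S (X 1) - T (X 1) ∈ filt w (w 1 + k))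
    {n : ℕ} {f : FormalSeries} (hf : f ∈ filt w n) : S f - T f ∈ filt w (n + k) := by
  have mul {a b : ℕ} {f g : FormalSeries} (hf : f ∈ filt w a) (hg : g ∈ filt w b)
      (hf' : S f - T f ∈ filt w (a + k)) (hg' : S g - T g ∈ filt w (b + k)) :
      S (f * g) - T (f * g) ∈ filt w (a + b + k) := by
    have e : S (f * g) - T (f * g) = (S f - T f) * S g + T f * (S g - T g) := by
      simp only [map_mul]; ring
    rw [e]
    exact Submodule.add_mem _ (filt_mono (by omega) (mul_mem_filt hf' (hS.map_filt hg)))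
      (filt_mono (by omega) (mul_mem_filt (hT.map_filt hf) hg'))
  have pow {a : ℕ} {f : FormalSeries} (hf : f ∈ filt w a) (hf' : S f - T f ∈ filt w (a + k))
      (j : ℕ) : S (f ^ j) - T (f ^ j) ∈ filt w (a * j + k) := by
    induction j with
    | zero => simp
    | succ j ih =>
      rw [pow_succ, Nat.mul_succ]
      exact mul (pow_mem_filt hf j) hf ih hf'
  have h2 : S (X 2) - T (X 2) ∈ filt w (w 2 + k) := by simp [hS.map_eps, hT.map_eps]
  refine map_mem_filt_of_monomial (A := S.toLinearMap - T.toLinearMap) (c := 0) (n := n) hw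
    (fun g hg => Submodule.sub_mem _ (hS.map_filt hg) (hT.map_filt hg)) (fun d hd => ?_) hf
  have := mul (mul_mem_filt (pow_mem_filt (X_mem_filt 0) (d 0)) (pow_mem_filt (X_mem_filt 1) (d 1)))
    (pow_mem_filt (X_mem_filt 2) (d 2))
    (mul (pow_mem_filt (X_mem_filt 0) (d 0)) (pow_mem_filt (X_mem_filt 1) (d 1))
      (pow (X_mem_filt 0) h0 _) (pow (X_mem_filt 1) h1 _)) (pow (X_mem_filt 2) h2 _)
  rw [← monomial_eq_mul] at this
  refine filt_mono ?_ this
  simp only [wt] at hd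
  omega

theorem IsFiltered.ext {w : Fin 3 → ℕ} (hw : ∀ i, 0 < w i)
    {S T : FormalSeries →ₐ[ℝ] FormalSeries} (hS : IsFiltered w S) (hT : IsFiltered w T)
    (h0 : S (X 0) = T (X 0)) (h1 : S (X 1) = T (X 1)) : S = T :=
  AlgHom.ext fun f => eq_of_forall_sub_mem_filt (w := w) fun n =>
    filt_mono (by omega) (hS.sub_mem_filt hw hT (k := n) (by simp [h0]) (by simp [h1])
      (mem_filt_zero f))

end FormalSeries

/-! ### Formal families as pullback endomorphisms. -/

namespace FormalFamily

open MvPowerSeries FormalSeries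

theorem FixesOrigin.hasSubst {F : FormalFamily} (hF : F.FixesOrigin) :
    HasSubst (S := ℝ) ![F 0, F 1, X 2] :=
  hasSubst_of_constantCoeff_zero fun i => by
    fin_cases i
    · exact hF 0
    · exact hF 1
    · simp

/-- The algebra endomorphism `f ↦ f ∘ F_ε`. -/
def pullback (F : FormalFamily) (hF : F.FixesOrigin) : FormalSeries →ₐ[ℝ] FormalSeries :=
  substAlgHom hF.hasSubst

theorem pullback_apply {F : FormalFamily} (hF : F.FixesOrigin) (f : FormalSeries) :
    F.pullback hF f = subst ![F 0, F 1, X 2] f := by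
  rw [pullback, coe_substAlgHom]

theorem pullback_X_castSucc {F : FormalFamily} (hF : F.FixesOrigin) (i : Fin 2) :
    F.pullback hF (X i.castSucc) = F i := by
  rw [pullback, substAlgHom_X]
  fin_cases i <;> rfl

@[simp]
theorem pullback_X_zero {F : FormalFamily} (hF : F.FixesOrigin) : F.pullback hF (X 0) = F 0 :=
  pullback_X_castSucc hF 0

@[simp]
theorem pullback_X_one {F : FormalFamily} (hF : F.FixesOrigin) : F.pullback hF (X 1) = F 1 :=
  pullback_X_castSucc hF 1

@[simp]
theorem pullback_X_two {F : FormalFamily} (hF : F.FixesOrigin) : F.pullback hF (X 2) = X 2 :=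
  substAlgHom_X _ _

theorem comp_apply (G : FormalFamily) {H : FormalFamily} (hH : H.FixesOrigin) (i : Fin 2) :
    G.comp H i = H.pullback hH (G i) :=
  (pullback_apply hH _).symm

theorem isFiltered_pullback {w : Fin 3 → ℕ} {F : FormalFamily} (hF : F.FixesOrigin)
    (h0 : F 0 ∈ filt w (w 0)) (h1 : F 1 ∈ filt w (w 1)) : IsFiltered w (F.pullback hF) := by
  refine ⟨pullback_X_two hF, fun {n f} hf d hd => ?_⟩
  rw [pullback_apply, coeff_subst hF.hasSubst, finsum_eq_zero_of_forall_eq_zero]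
  intro e
  by_cases he : wt w e < n
  · rw [hf e he, zero_smul]
  · have := mul_mem_filt (mul_mem_filt (pow_mem_filt h0 (e 0)) (pow_mem_filt h1 (e 1)))
      (pow_mem_filt (X_mem_filt (w := w) 2) (e 2))
    rw [Finsupp.prod_fintype _ _ (by simp), Fin.prod_univ_three]
    change coeff e f • coeff d (F 0 ^ e 0 * F 1 ^ e 1 * X 2 ^ e 2) = 0
    rw [this d (by simp only [wt] at he hd ⊢; omega), smul_zero]

theorem FixesOrigin.mem_filt_one {F : FormalFamily} (hF : F.FixesOrigin) (i : Fin 2) :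
    F i ∈ filt (fun _ => 1) 1 := by
  intro d hd
  have : d = 0 := by
    ext i
    have := le_wt (w := fun _ => 1) (fun _ => one_pos) d i
    simp only [Finsupp.coe_zero, Pi.zero_apply]
    omega
  rw [this, coeff_zero_eq_constantCoeff]
  exact hF i

theorem FixesOrigin.isFiltered {F : FormalFamily} (hF : F.FixesOrigin) :
    IsFiltered (fun _ => 1) (F.pullback hF) :=
  isFiltered_pullback hF (hF.mem_filt_one 0) (hF.mem_filt_one 1)

theorem fixesOrigin_of_mem_filt {w : Fin 3 → ℕ} (hw : ∀ i, 0 < w i) {F : FormalFamily}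
    (h : ∀ i, F i ∈ filt w (w i.castSucc)) : F.FixesOrigin := fun i => by
  rw [← coeff_zero_eq_constantCoeff_apply]
  exact h i 0 (by simpa [wt] using hw i.castSucc)

theorem constantCoeff_pullback {F : FormalFamily} (hF : F.FixesOrigin) (f : FormalSeries) :
    constantCoeff (F.pullback hF f) = constantCoeff f := by
  have h : f - C (constantCoeff f) ∈ filt (fun _ => 1) 1 := by
    intro d hd
    have : d = 0 := by
      ext i
      have := le_wt (w := fun _ => 1) (fun _ => one_pos) d i
      simp only [Finsupp.coe_zero, Pi.zero_apply]
      omega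
    simp [this]
  have h' := hF.isFiltered.map_filt h 0 (by simp [wt])
  have e : (C (constantCoeff f) : FormalSeries) = algebraMap ℝ FormalSeries (constantCoeff f) := rfl
  rw [map_sub, e, AlgHom.commutes, ← e, map_sub, sub_eq_zero] at h'
  simpa using h'

theorem FixesOrigin.comp {G H : FormalFamily} (hG : G.FixesOrigin) (hH : H.FixesOrigin) :
    (G.comp H).FixesOrigin := fun i => by
  rw [comp_apply G hH, constantCoeff_pullback, hG i]

/-- Pullback is contravariant. Both sides are filtered, so agreement at `x` and `y` suffices. -/
theorem pullback_comp {G H : FormalFamily} (hG : G.FixesOrigin) (hH : H.FixesOrigin) :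
    (G.comp H).pullback (hG.comp hH) = (H.pullback hH).comp (G.pullback hG) := by
  refine IsFiltered.ext (w := fun _ => 1) (fun _ => one_pos) (hG.comp hH).isFiltered
    (hH.isFiltered.comp hG.isFiltered) ?_ ?_ <;> simp [comp_apply G hH]

theorem comp_assoc (F : FormalFamily) {G H : FormalFamily} (hG : G.FixesOrigin)
    (hH : H.FixesOrigin) : (F.comp G).comp H = F.comp (G.comp H) := by
  funext i
  rw [comp_apply _ hH, comp_apply _ hG, comp_apply _ (hG.comp hH), pullback_comp hG hH,
    AlgHom.comp_apply]

theorem identity_comp {F : FormalFamily} (hF : F.FixesOrigin) : identity.comp F = F := by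
  funext i
  rw [comp_apply _ hF, identity, pullback_X_castSucc]

theorem comp_identity (F : FormalFamily) : F.comp identity = F := by
  funext i
  rw [comp, show (![identity 0, identity 1, X 2] : Fin 3 → FormalSeries) = X from ?_, subst_self]
  · rfl
  · funext j; fin_cases j <;> rfl

/-- The family whose pullback is a given filtered endomorphism. -/
def ofAlgHom (S : FormalSeries →ₐ[ℝ] FormalSeries) : FormalFamily := fun i => S (X i.castSucc)

theorem ofAlgHom_fixesOrigin {w : Fin 3 → ℕ} (hw : ∀ i, 0 < w i)
    {S : FormalSeries →ₐ[ℝ] FormalSeries} (hS : IsFiltered w S) : (ofAlgHom S).FixesOrigin :=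
  fixesOrigin_of_mem_filt hw fun i => hS.map_filt (X_mem_filt i.castSucc)

theorem pullback_ofAlgHom {w : Fin 3 → ℕ} (hw : ∀ i, 0 < w i)
    {S : FormalSeries →ₐ[ℝ] FormalSeries} (hS : IsFiltered w S) :
    (ofAlgHom S).pullback (ofAlgHom_fixesOrigin hw hS) = S :=
  IsFiltered.ext hw (isFiltered_pullback _ (hS.map_filt (X_mem_filt 0))
    (hS.map_filt (X_mem_filt 1))) hS (by simp [ofAlgHom]) (by simp [ofAlgHom])

end FormalFamily

/-! ### The Poisson bracket and the chain rule. -/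

namespace FormalSeries

open MvPowerSeries

/-- The Lie derivative as a linear map. -/
def lie : FormalSeries →ₗ[ℝ] Module.End ℝ FormalSeries :=
  LinearMap.mk₂ ℝ lieDerivative
    (fun a b c => by simp only [lieDerivative, map_add]; ring)
    (fun r a b => by simp only [lieDerivative, Derivation.map_smul, mul_smul_comm, smul_sub])
    (fun a b c => by simp only [lieDerivative, map_add]; ring)
    (fun r a b => by simp only [lieDerivative, Derivation.map_smul, smul_mul_assoc, smul_sub])

theorem lie_apply (h g : FormalSeries) :
    lie h g = pderiv ℝ 0 g * pderiv ℝ 1 h - pderiv ℝ 1 g * pderiv ℝ 0 h := rfl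

theorem coe_lie (h : FormalSeries) : ⇑(lie h) = lieDerivative h := rfl

theorem pderiv_comm (i j : Fin 3) (f : FormalSeries) :
    pderiv ℝ i (pderiv ℝ j f) = pderiv ℝ j (pderiv ℝ i f) := by
  ext d
  simp only [coeff_pderiv]
  rw [add_right_comm]
  by_cases h : i = j
  · subst h; rfl
  · simp [h, Ne.symm h]; ring

theorem lie_mul (h f g : FormalSeries) : lie h (f * g) = lie h f * g + f * lie h g := by
  simp only [lie_apply, Derivation.leibniz, smul_eq_mul]; ring

/-- The Jacobi identity. It makes `lie h` a derivation of the bracket, so that its exponential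
preserves the bracket, and it identifies the commutator of two Lie derivatives. -/
theorem lie_lie (h f g : FormalSeries) : lie h (lie f g) = lie (lie h f) g + lie f (lie h g) := by
  simp only [lie_apply]
  simp only [Derivation.leibniz, smul_eq_mul, map_sub, pderiv_comm 1 0]
  ring

@[simp] theorem lie_X_zero (h : FormalSeries) : lie h (X 0) = pderiv ℝ 1 h := by simp [lie_apply]
@[simp] theorem lie_X_one (h : FormalSeries) : lie h (X 1) = - pderiv ℝ 0 h := by simp [lie_apply]
@[simp] theorem lie_X_two (h : FormalSeries) : lie h (X 2) = 0 := by simp [lie_apply]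
@[simp] theorem lie_one (h : FormalSeries) : lie h 1 = 0 := by simp [lie_apply]

/-- The chain rule for a filtered endomorphism. -/
theorem IsFiltered.pderiv_map {w : Fin 3 → ℕ} (hw : ∀ i, 0 < w i)
    {S : FormalSeries →ₐ[ℝ] FormalSeries} (hS : IsFiltered w S) {j : Fin 3} (hj : j ≠ 2)
    (f : FormalSeries) : pderiv ℝ j (S f) =
      S (pderiv ℝ 0 f) * pderiv ℝ j (S (X 0)) + S (pderiv ℝ 1 f) * pderiv ℝ j (S (X 1)) := by
  let A : FormalSeries →ₗ[ℝ] FormalSeries := (pderiv ℝ j).toLinearMap ∘ₗ S.toLinearMap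
  let B : FormalSeries →ₗ[ℝ] FormalSeries :=
    (LinearMap.mulRight ℝ (pderiv ℝ j (S (X 0)))) ∘ₗ S.toLinearMap ∘ₗ (pderiv ℝ 0).toLinearMap +
    (LinearMap.mulRight ℝ (pderiv ℝ j (S (X 1)))) ∘ₗ S.toLinearMap ∘ₗ (pderiv ℝ 1).toLinearMap
  have hA (f : FormalSeries) : A f = pderiv ℝ j (S f) := rfl
  have hB (f : FormalSeries) : B f =
    S (pderiv ℝ 0 f) * pderiv ℝ j (S (X 0)) + S (pderiv ℝ 1 f) * pderiv ℝ j (S (X 1)) := rfl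
  have hmul {f g : FormalSeries} (hf : A f = B f) (hg : A g = B g) : A (f * g) = B (f * g) := by
    simp only [hA, hB, map_mul, Derivation.leibniz, smul_eq_mul, map_add] at hf hg ⊢
    rw [hf, hg]; ring
  have hpow {f : FormalSeries} (hf : A f = B f) (k : ℕ) : A (f ^ k) = B (f ^ k) := by
    induction k with
    | zero => simp [hA, hB]
    | succ k ih => rw [pow_succ]; exact hmul ih hf
  have h0 : A (X 0) = B (X 0) := by simp [hA, hB]
  have h1 : A (X 1) = B (X 1) := by simp [hA, hB]
  have h2 : A (X 2) = B (X 2) := by simp [hA, hB, hS.map_eps, pderiv_X_of_ne hj.symm]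
  rw [← hA, ← hB]
  congr 1
  -- The sum of the weights bounds the loss of weight under every partial derivative at once.
  refine linearMap_eq_of_monomial (w := w) (c := w 0 + w 1 + w 2) hw (fun m f hf => ?_)
    (fun m f hf => ?_) fun d => ?_
  · exact pderiv_mem_filt (by fin_cases j <;> simp <;> omega) (hS.map_filt hf)
  · refine Submodule.add_mem _ ?_ ?_
    · exact filt_mono (by omega) (mul_mem_filt (m := m) (n := 0)
        (hS.map_filt (pderiv_mem_filt (by omega) hf)) (mem_filt_zero _))
    · exact filt_mono (by omega) (mul_mem_filt (m := m) (n := 0)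
        (hS.map_filt (pderiv_mem_filt (by omega) hf)) (mem_filt_zero _))
  · rw [monomial_eq_mul]
    exact hmul (hmul (hpow h0 _) (hpow h1 _)) (hpow h2 _)

/-- In dimension two the bracket is a Jacobian determinant, so the chain rule makes it
multiplicative. -/
theorem IsFiltered.lie_map {w : Fin 3 → ℕ} (hw : ∀ i, 0 < w i)
    {S : FormalSeries →ₐ[ℝ] FormalSeries} (hS : IsFiltered w S) (g f : FormalSeries) :
    lie (S g) (S f) = S (lie g f) * lie (S (X 1)) (S (X 0)) := by
  simp only [lie_apply, hS.pderiv_map hw (show (0 : Fin 3) ≠ 2 by decide) f,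
    hS.pderiv_map hw (show (1 : Fin 3) ≠ 2 by decide) f,
    hS.pderiv_map hw (show (0 : Fin 3) ≠ 2 by decide) g,
    hS.pderiv_map hw (show (1 : Fin 3) ≠ 2 by decide) g, map_sub, map_mul]
  ring

end FormalSeries

namespace FormalFamily

open MvPowerSeries FormalSeries

theorem det_jacobian (F : FormalFamily) : F.jacobian.det = lie (F 1) (F 0) := by
  rw [Matrix.det_fin_two, lie_apply]
  simp only [jacobian, Matrix.of_apply, Fin.castSucc_zero, Fin.castSucc_one]

theorem det_jacobian_comp (G : FormalFamily) {H : FormalFamily} (hH : H.FixesOrigin) :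
    (G.comp H).jacobian.det = H.pullback hH G.jacobian.det * H.jacobian.det := by
  simp only [det_jacobian, comp_apply G hH]
  rw [hH.isFiltered.lie_map (fun _ => one_pos)]
  simp

end FormalFamily

/-! ### Exponentials of operators that raise weights. -/

namespace FormalSeries

open MvPowerSeries

/-- The quasi-homogeneous weights of `x`, `y`, `ε`, for which `y²`, `x³` and `ε` have weight `6`. -/
def qw : Fin 3 → ℕ := ![2, 3, 6]

theorem qw_pos (i : Fin 3) : 0 < qw i := by fin_cases i <;> simp [qw]

@[simp] theorem qw_zero : qw 0 = 2 := rfl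
@[simp] theorem qw_one : qw 1 = 3 := rfl
@[simp] theorem qw_two : qw 2 = 6 := rfl

theorem wt_qw (d : Fin 3 →₀ ℕ) : wt qw d = 2 * d 0 + 3 * d 1 + 6 * d 2 := rfl

/-- The linear operators that raise the quasi-homogeneous weight by at least `k`. -/
def raising (k : ℕ) : Submodule ℝ (Module.End ℝ FormalSeries) where
  carrier := {A | ∀ n, ∀ f ∈ filt qw n, A f ∈ filt qw (n + k)}
  add_mem' hA hB n f hf := Submodule.add_mem _ (hA n f hf) (hB n f hf)
  zero_mem' _ _ _ := Submodule.zero_mem _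
  smul_mem' c _ hA n f hf := Submodule.smul_mem _ c (hA n f hf)

theorem raising_mono {j k : ℕ} (h : j ≤ k) {A : Module.End ℝ FormalSeries} (hA : A ∈ raising k) :
    A ∈ raising j := fun n f hf => filt_mono (by omega) (hA n f hf)

theorem mul_mem_raising {j k : ℕ} {A B : Module.End ℝ FormalSeries} (hA : A ∈ raising j)
    (hB : B ∈ raising k) : A * B ∈ raising (j + k) := fun n f hf =>
  filt_mono (by omega) (hA _ _ (hB n f hf))

theorem one_mem_raising : (1 : Module.End ℝ FormalSeries) ∈ raising 0 := fun _ _ hf => hf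

theorem pow_mem_raising {j : ℕ} {A : Module.End ℝ FormalSeries} (hA : A ∈ raising j) (k : ℕ) :
    A ^ k ∈ raising (j * k) := by
  induction k with
  | zero => exact one_mem_raising
  | succ k ih => rw [pow_succ, Nat.mul_succ]; exact mul_mem_raising ih hA

/-- Each term of the bracket carries one derivative in `x` and one in `y`, at a cost of 2 + 3 = 5.
-/
theorem lie_mem_filt {m n k : ℕ} (hk : k + 5 ≤ m + n) {h f : FormalSeries} (hh : h ∈ filt qw m)
    (hf : f ∈ filt qw n) : lie h f ∈ filt qw k := by
  rw [lie_apply]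
  exact Submodule.sub_mem _
    (filt_mono (by simp; omega) (mul_mem_filt (pderiv_mem_filt (le_refl (n - qw 0)) hf)
      (pderiv_mem_filt (le_refl (m - qw 1)) hh)))
    (filt_mono (by simp; omega) (mul_mem_filt (pderiv_mem_filt (le_refl (n - qw 1)) hf)
      (pderiv_mem_filt (le_refl (m - qw 0)) hh)))

theorem lie_mem_raising {k : ℕ} {h : FormalSeries} (hh : h ∈ filt qw (k + 5)) :
    lie h ∈ raising k := fun _ _ hf => lie_mem_filt (by omega) hh hf

/-- The partial sum of the exponential series. -/
def expSum (D : Module.End ℝ FormalSeries) (n : ℕ) : Module.End ℝ FormalSeries :=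
  ∑ k ∈ Finset.range n, ((k.factorial : ℝ)⁻¹) • D ^ k

theorem expSum_succ (D : Module.End ℝ FormalSeries) (n : ℕ) :
    expSum D (n + 1) = expSum D n + ((n.factorial : ℝ)⁻¹) • D ^ n := Finset.sum_range_succ _ _

theorem expSum_sub_mem_raising {p : ℕ} {D : Module.End ℝ FormalSeries} (hD : D ∈ raising p)
    {m n : ℕ} (h : m ≤ n) : expSum D n - expSum D m ∈ raising (p * m) := by
  induction n, h using Nat.le_induction with
  | base => simp
  | succ n hn ih =>
    rw [expSum_succ, add_sub_right_comm]
    exact Submodule.add_mem _ ih (Submodule.smul_mem _ _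
      (raising_mono (Nat.mul_le_mul_left p hn) (pow_mem_raising hD n)))

/-- The exponential of an operator that raises weights. -/
def expOp (D : Module.End ℝ FormalSeries) : Module.End ℝ FormalSeries where
  -- If `D` raises weights by at least 1, powers beyond `wt qw d` do not reach the coefficient at
  -- `d`, so this truncation is exact.
  toFun f := ofCoeff fun d => coeff d (expSum D (wt qw d + 1) f)
  map_add' f g := by ext d; simp
  map_smul' c f := by ext d; simp

theorem coeff_expOp (D : Module.End ℝ FormalSeries) (f : FormalSeries) (d : Fin 3 →₀ ℕ) :
    coeff d (expOp D f) = coeff d (expSum D (wt qw d + 1) f) := rfl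

theorem expOp_sub_expSum_mem_raising {p : ℕ} (hp : 0 < p) {D : Module.End ℝ FormalSeries}
    (hD : D ∈ raising p) (n : ℕ) : expOp D - expSum D n ∈ raising (p * n) := by
  intro m f hf d hd
  rw [LinearMap.sub_apply, map_sub, coeff_expOp, ← map_sub, ← LinearMap.sub_apply]
  rcases le_total n (wt qw d + 1) with h | h
  · exact expSum_sub_mem_raising hD h m f hf d hd
  · have := expSum_sub_mem_raising hD h m f hf d (by nlinarith)
    rw [← neg_sub, LinearMap.neg_apply, map_neg, this, neg_zero]

theorem coeff_expSum_eq {D : Module.End ℝ FormalSeries} (hD : D ∈ raising 1) (f : FormalSeries)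
    {d : Fin 3 →₀ ℕ} {n : ℕ} (hn : wt qw d < n) :
    coeff d (expSum D n f) = coeff d (expOp D f) := by
  have := expOp_sub_expSum_mem_raising one_pos hD n 0 f (mem_filt_zero f) d (by omega)
  rw [LinearMap.sub_apply, map_sub, sub_eq_zero] at this
  exact this.symm

theorem expOp_sub_one_mem_raising {p : ℕ} (hp : 0 < p) {D : Module.End ℝ FormalSeries}
    (hD : D ∈ raising p) : expOp D - 1 ∈ raising p := by
  simpa [expSum] using expOp_sub_expSum_mem_raising hp hD 1

theorem expOp_sub_one_sub_mem_raising {p : ℕ} (hp : 0 < p) {D : Module.End ℝ FormalSeries}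
    (hD : D ∈ raising p) : expOp D - 1 - D ∈ raising (p * 2) := by
  have := expOp_sub_expSum_mem_raising hp hD 2
  simpa [expSum, Finset.sum_range_succ, sub_sub] using this

/-- Every word in the expansion of the difference contains a factor `D'`, worth n + 1, and k − 1
other factors, worth at least 1 each. No commutation is needed. -/
theorem add_pow_sub_pow_mem_raising {n : ℕ} {D D' : Module.End ℝ FormalSeries}
    (hD : D ∈ raising 1) (hD' : D' ∈ raising (n + 1)) (k : ℕ) :
    (D + D') ^ k - D ^ k ∈ raising (n + k) := by
  induction k with
  | zero => simp
  | succ k ih =>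
    have e : (D + D') ^ (k + 1) - D ^ (k + 1) = ((D + D') ^ k - D ^ k) * (D + D') + D ^ k * D' := by
      rw [pow_succ, pow_succ]; simp only [mul_add, sub_mul]; abel
    rw [e]
    refine Submodule.add_mem _ (mul_mem_raising (k := 1) ih
      (Submodule.add_mem _ hD (raising_mono (by omega) hD'))) ?_
    exact raising_mono (by omega) (mul_mem_raising (pow_mem_raising hD k) hD')

/-- The exponential is linear in a small perturbation at leading order: in the terms of degree at
least 2, each `D'` is accompanied by another factor that raises weights. -/
theorem expOp_add_sub_mem_raising {n : ℕ} {D D' : Module.End ℝ FormalSeries}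
    (hD : D ∈ raising 1) (hD' : D' ∈ raising n) (hn : 1 ≤ n) :
    expOp (D + D') - expOp D - D' ∈ raising (n + 1) := by
  obtain ⟨n, rfl⟩ := Nat.exists_eq_add_of_le' hn
  have hsum (m : ℕ) : expSum (D + D') (m + 2) - expSum D (m + 2) - D' ∈ raising (n + 2) := by
    induction m with
    | zero => simp [expSum, Finset.sum_range_succ]
    | succ m ih =>
      rw [expSum_succ _ (m + 2), expSum_succ _ (m + 2)]
      have e (a b c d e : Module.End ℝ FormalSeries) (r : ℝ) :
        a + r • c - (b + r • d) - e = (a - b - e) + r • (c - d) := by module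
      rw [e]
      exact Submodule.add_mem _ ih (Submodule.smul_mem _ _ (raising_mono (by omega)
        (add_pow_sub_pow_mem_raising hD hD' (m + 2))))
  have h1 := expOp_sub_expSum_mem_raising one_pos
    (Submodule.add_mem _ hD (raising_mono (by omega) hD')) (n + 2)
  have h2 := expOp_sub_expSum_mem_raising one_pos hD (n + 2)
  rw [one_mul] at h1 h2
  convert Submodule.add_mem _ (Submodule.sub_mem _ h1 h2) (hsum n) using 1
  abel

/-- The exponential of a derivation of a bilinear product is multiplicative. -/
theorem expOp_bilin {D : Module.End ℝ FormalSeries} (hD : D ∈ raising 1)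
    (B : FormalSeries →ₗ[ℝ] FormalSeries →ₗ[ℝ] FormalSeries) {c : ℕ}
    (hB : ∀ m n k f g, k + c ≤ m + n → f ∈ filt qw m → g ∈ filt qw n → B f g ∈ filt qw k)
    (hDB : ∀ f g, D (B f g) = B (D f) g + B f (D g)) (f g : FormalSeries) :
    expOp D (B f g) = B (expOp D f) (expOp D g) := by
  let a (n : ℕ) (f : FormalSeries) : FormalSeries := ((n.factorial : ℝ)⁻¹) • (D ^ n) f
  have ha (n : ℕ) (f : FormalSeries) : D (a n f) = ((n : ℝ) + 1) • a (n + 1) f := by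
    simp only [a, map_smul, smul_smul, pow_succ', Module.End.mul_apply, Nat.factorial_succ]
    congr 1
    push_cast
    field_simp
  -- The Leibniz rule for divided powers `D^n / n!`, which needs no binomial coefficients.
  have hconv (n : ℕ) : a n (B f g) = ∑ p ∈ Finset.HasAntidiagonal.antidiagonal n, B (a p.1 f) (a p.2 g) := by
    induction n with
    | zero => simp [a]
    | succ n ih =>
      have hn : ((n : ℝ) + 1) ≠ 0 := by positivity
      refine smul_right_injective _ hn ?_
      dsimp only
      rw [← ha, ih, map_sum]
      simp only [hDB, ha, map_smul, LinearMap.smul_apply]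
      have hR : ((n : ℝ) + 1) • ∑ p ∈ Finset.HasAntidiagonal.antidiagonal (n + 1), B (a p.1 f) (a p.2 g) =
          ∑ p ∈ Finset.HasAntidiagonal.antidiagonal (n + 1), ((p.1 : ℝ) • B (a p.1 f) (a p.2 g) +
            (p.2 : ℝ) • B (a p.1 f) (a p.2 g)) := by
        rw [Finset.smul_sum]
        refine Finset.sum_congr rfl fun p hp => ?_
        rw [Finset.HasAntidiagonal.mem_antidiagonal] at hp
        rw [← add_smul]
        congr 1
        exact_mod_cast hp.symm
      rw [hR, Finset.sum_add_distrib, Finset.sum_add_distrib, Finset.Nat.sum_antidiagonal_succ,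
        Finset.Nat.sum_antidiagonal_succ']
      simp
  have hmem (n : ℕ) (f : FormalSeries) : a n f ∈ filt qw n :=
    Submodule.smul_mem _ _ (filt_mono (by omega) (pow_mem_raising hD n 0 f (mem_filt_zero f)))
  have hpart (n : ℕ) (f : FormalSeries) : expSum D n f = ∑ k ∈ Finset.range n, a k f := by
    simp [expSum, a]
  have happrox (n : ℕ) (f : FormalSeries) : expOp D f - expSum D n f ∈ filt qw n :=
    filt_mono (by omega) (expOp_sub_expSum_mem_raising one_pos hD n 0 f (mem_filt_zero f))
  refine eq_of_forall_sub_mem_filt (w := qw) fun n => ?_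
  set N := n + c
  -- The left sum runs over the triangle p.1 + p.2 < N, the right one over the whole square. The
  -- remaining terms have weight at least N − c = n.
  have hcauchy : expSum D N (B f g) - B (expSum D N f) (expSum D N g) ∈ filt qw n := by
    have e : B (expSum D N f) (expSum D N g) =
        ∑ p ∈ Finset.range N ×ˢ Finset.range N, B (a p.1 f) (a p.2 g) := by
      rw [hpart, hpart, Finset.sum_product_right]
      simp only [map_sum, LinearMap.sum_apply]
    have e' : expSum D N (B f g) = ∑ p ∈ (Finset.range N ×ˢ Finset.range N) with p.1 + p.2 < N,
        B (a p.1 f) (a p.2 g) := by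
      rw [hpart]
      simp only [hconv]
      rw [Finset.sum_sigma']
      refine Finset.sum_bij' (fun q _ => q.2) (fun p _ => ⟨p.1 + p.2, p⟩) ?_ ?_ ?_ ?_ ?_
      · rintro ⟨k, p⟩ h; simp at h ⊢; omega
      · rintro p h; simp at h ⊢; omega
      · rintro ⟨k, p⟩ h; simp at h ⊢; omega
      · rintro p h; rfl
      · rintro ⟨k, p⟩ h; rfl
    rw [e, e', ← Finset.sum_filter_add_sum_filter_not (Finset.range N ×ˢ Finset.range N)
      (fun p => p.1 + p.2 < N), sub_add_cancel_left]
    refine Submodule.neg_mem _ (Submodule.sum_mem _ fun p hp => ?_)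
    simp only [Finset.mem_filter] at hp
    exact hB p.1 p.2 n _ _ (by omega) (hmem _ _) (hmem _ _)
  have hdiff : B (expOp D f) (expOp D g) - B (expSum D N f) (expSum D N g) ∈ filt qw n := by
    have e : B (expOp D f) (expOp D g) - B (expSum D N f) (expSum D N g) =
        B (expOp D f - expSum D N f) (expOp D g) + B (expSum D N f) (expOp D g - expSum D N g) := by
      simp only [map_sub, LinearMap.sub_apply]; abel
    rw [e]
    exact Submodule.add_mem _ (hB N 0 n _ _ (by omega) (happrox N f) (mem_filt_zero _))
      (hB 0 N n _ _ (by omega) (mem_filt_zero _) (happrox N g))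
  have := Submodule.sub_mem _ (Submodule.add_mem _ (filt_mono (show n ≤ N by omega)
    (happrox N (B f g))) hcauchy) hdiff
  convert this using 1
  abel

theorem expOp_eq_self {D : Module.End ℝ FormalSeries} {f : FormalSeries} (h : D f = 0) :
    expOp D f = f := by
  ext d
  rw [coeff_expOp, expSum, LinearMap.sum_apply, Finset.sum_eq_single 0]
  · simp
  · intro k _ hk
    obtain ⟨k, rfl⟩ := Nat.exists_eq_succ_of_ne_zero hk
    simp [pow_succ, h]
  · simp

/-- The endomorphism `exp L_h` for a Hamiltonian of weight at least `6`. -/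
def expLie (h : FormalSeries) (hh : h ∈ filt qw 6) : FormalSeries →ₐ[ℝ] FormalSeries :=
  AlgHom.ofLinearMap (expOp (lie h)) (expOp_eq_self (lie_one h)) fun f g =>
    expOp_bilin (lie_mem_raising hh) (LinearMap.mul ℝ FormalSeries) (c := 0)
      (fun _ _ _ _ _ hk hf hg => filt_mono hk (mul_mem_filt hf hg)) (lie_mul h) f g

theorem expLie_apply {h : FormalSeries} (hh : h ∈ filt qw 6) (f : FormalSeries) :
    expLie h hh f = expOp (lie h) f := rfl

/-- The multiplicativity of the exponential, applied to the bracket as bilinear product; the Jacobi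
identity is its Leibniz rule. -/
theorem lie_expLie {h : FormalSeries} (hh : h ∈ filt qw 6) (f g : FormalSeries) :
    lie (expLie h hh f) (expLie h hh g) = expLie h hh (lie f g) :=
  (expOp_bilin (lie_mem_raising hh) lie (c := 5)
    (fun _ _ _ _ _ hk hf hg => lie_mem_filt hk hf hg) (lie_lie h) f g).symm

/-- An algebra endomorphism which is the identity up to terms of higher weight. -/
structure IsUnipotent (S : FormalSeries →ₐ[ℝ] FormalSeries) : Prop where
  map_eps : S (X 2) = X 2
  sub_one : S.toLinearMap - 1 ∈ raising 1

theorem IsUnipotent.sub_mem {S : FormalSeries →ₐ[ℝ] FormalSeries} (hS : IsUnipotent S) {n : ℕ}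
    {f : FormalSeries} (hf : f ∈ filt qw n) : S f - f ∈ filt qw (n + 1) := hS.sub_one n f hf

theorem IsUnipotent.isFiltered {S : FormalSeries →ₐ[ℝ] FormalSeries} (hS : IsUnipotent S) :
    IsFiltered qw S := by
  refine ⟨hS.map_eps, fun {n f} hf => ?_⟩
  have := Submodule.add_mem _ (filt_mono (by omega) (hS.sub_mem hf)) hf
  rwa [sub_add_cancel] at this

theorem IsUnipotent.comp {S T : FormalSeries →ₐ[ℝ] FormalSeries} (hS : IsUnipotent S)
    (hT : IsUnipotent T) : IsUnipotent (S.comp T) := by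
  refine ⟨by simp [hT.map_eps, hS.map_eps], fun n f hf => ?_⟩
  have := Submodule.add_mem _ (hS.sub_mem (hT.isFiltered.map_filt hf)) (hT.sub_mem hf)
  rwa [sub_add_sub_cancel] at this

theorem isUnipotent_id : IsUnipotent (AlgHom.id ℝ FormalSeries) :=
  ⟨rfl, fun n f _ => by simp⟩

theorem isUnipotent_expLie {h : FormalSeries} (hh : h ∈ filt qw 6) : IsUnipotent (expLie h hh) :=
  ⟨expOp_eq_self (lie_X_two h), expOp_sub_one_mem_raising one_pos (lie_mem_raising hh)⟩

theorem IsFiltered.isUnipotent {S : FormalSeries →ₐ[ℝ] FormalSeries} (hS : IsFiltered qw S)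
    (h0 : S (X 0) - X 0 ∈ filt qw 3) (h1 : S (X 1) - X 1 ∈ filt qw 4) : IsUnipotent S :=
  ⟨hS.map_eps, fun _ _ hf => hS.sub_mem_filt qw_pos (T := AlgHom.id ℝ _)
    isUnipotent_id.isFiltered (k := 1) h0 h1 hf⟩

/-- `S − 1` raises weights, hence e ↦ g − (S e − e) is a contraction for the weight topology, and
its fixed point is a preimage of `g`. -/
theorem IsUnipotent.bijective {S : FormalSeries →ₐ[ℝ] FormalSeries} (hS : IsUnipotent S) :
    Function.Bijective S := by
  constructor
  · refine (injective_iff_map_eq_zero S).2 fun f hf => eq_zero_of_forall_mem_filt (w := qw) ?_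
    intro n
    induction n with
    | zero => exact mem_filt_zero f
    | succ n ih => simpa [hf] using hS.sub_mem ih
  · intro g
    let f (n : ℕ) : FormalSeries := (fun e => g - (S e - e))^[n] 0
    have hf (n : ℕ) : f (n + 1) = g - (S (f n) - f n) := Function.iterate_succ_apply' _ _ _
    have hstep (n : ℕ) : f (n + 1) - f n ∈ filt qw n := by
      induction n with
      | zero => exact mem_filt_zero _
      | succ n ih =>
        have := Submodule.neg_mem _ (hS.sub_mem ih)
        convert this using 1
        rw [hf (n + 1)]
        nth_rewrite 3 [hf n]
        rw [map_sub]
        abel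
    obtain ⟨e, he⟩ := exists_limit f hstep
    refine ⟨e, eq_of_forall_sub_mem_filt (w := qw) fun n => ?_⟩
    have h1 := hS.isFiltered.map_filt (he n)
    have h2 := hstep n
    rw [hf n] at h2
    convert Submodule.sub_mem _ h1 h2 using 1
    rw [map_sub]
    abel

end FormalSeries

/-! ### The homological equation and Hamiltonian vector fields. -/

namespace FormalSeries

open MvPowerSeries

/-- The formal series `U_ε(x) = ∑_{k + 3m ≥ 3} u_{km} x^k ε^m`. -/
def potentials : Submodule ℝ FormalSeries where
  carrier := {U | ∀ d, ¬ (d 1 = 0 ∧ 3 ≤ d 0 + 3 * d 2) → coeff d U = 0}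
  add_mem' hf hg d hd := by simp [hf d hd, hg d hd]
  zero_mem' d _ := by simp
  smul_mem' c f hf d hd := by simp [hf d hd]

theorem coeff_of_mem_potentials {U : FormalSeries} (hU : U ∈ potentials) {d : Fin 3 →₀ ℕ}
    (hd : ¬ (d 1 = 0 ∧ 3 ≤ d 0 + 3 * d 2)) : coeff d U = 0 := hU d hd

theorem potentials_le_filt {U : FormalSeries} (hU : U ∈ potentials) : U ∈ filt qw 6 := fun d hd =>
  hU d (by rw [wt_qw] at hd; omega)

theorem pderiv_one_of_mem_potentials {U : FormalSeries} (hU : U ∈ potentials) :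
    pderiv ℝ 1 U = 0 := by
  ext d
  rw [coeff_pderiv, hU _ (by simp), zero_mul, map_zero]

theorem exists_eq_potential {U : FormalSeries} (hU : U ∈ potentials) : ∃ u, U = potential u := by
  refine ⟨fun k m => coeff (Finsupp.single 0 k + Finsupp.single 2 m) U, ?_⟩
  ext d
  change _ = if d 1 = 0 ∧ 3 ≤ d 0 + 3 * d 2 then
    coeff (Finsupp.single 0 (d 0) + Finsupp.single 2 (d 2)) U else 0
  split_ifs with h
  · congr 1
    congr 1
    ext i
    fin_cases i <;> simp [h.1]
  · exact hU d h

/-- The Hamiltonian `y² / 2 + U`. -/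
def ham (U : FormalSeries) : FormalSeries := C (1 / 2 : ℝ) * X 1 ^ 2 + U

theorem ham_add (U V : FormalSeries) : ham (U + V) = ham U + V := by
  simp only [ham]; ring

theorem C_mul_mem_filt {n : ℕ} {f : FormalSeries} (c : ℝ) (hf : f ∈ filt qw n) :
    C c * f ∈ filt qw n := by
  rw [← smul_eq_C_mul]; exact Submodule.smul_mem _ c hf

theorem ham_mem_filt {U : FormalSeries} (hU : U ∈ filt qw 6) : ham U ∈ filt qw 6 :=
  Submodule.add_mem _ (C_mul_mem_filt _ (pow_mem_filt (X_mem_filt (w := qw) 1) 2)) hU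

theorem pderiv_zero_ham (U : FormalSeries) : pderiv ℝ 0 (ham U) = pderiv ℝ 0 U := by
  simp [ham, Derivation.leibniz, Derivation.leibniz_pow]

theorem pderiv_one_ham {U : FormalSeries} (hU : U ∈ potentials) : pderiv ℝ 1 (ham U) = X 1 := by
  have h : (C (1 / 2 : ℝ) : FormalSeries) * 2 = 1 := by
    rw [show (2 : FormalSeries) = C (2 : ℝ) from (map_ofNat C 2).symm, ← map_mul]
    norm_num
  simp only [ham, map_add, Derivation.leibniz, Derivation.leibniz_pow,
    pderiv_one_of_mem_potentials hU, pderiv_C, pderiv_X_self, smul_eq_mul]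
  simp only [nsmul_eq_mul, Nat.cast_ofNat]
  linear_combination (X 1 : FormalSeries) * h

theorem lie_ham {U : FormalSeries} (hU : U ∈ potentials) (χ : FormalSeries) :
    lie (ham U) χ = pderiv ℝ 0 χ * X 1 - pderiv ℝ 1 χ * pderiv ℝ 0 U := by
  rw [lie_apply, pderiv_one_ham hU, pderiv_zero_ham]

/-- The part of a series that does not depend on `y`. -/
def restrict (g : FormalSeries) : FormalSeries := ofCoeff fun d => if d 1 = 0 then coeff d g else 0

theorem restrict_mem_filt {g : FormalSeries} {n : ℕ} (hg : g ∈ filt qw n) :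
    restrict g ∈ filt qw n := fun d hd => by simp [restrict, hg d hd]

theorem restrict_mem_potentials {g : FormalSeries} (hg : g ∈ filt qw 6) :
    restrict g ∈ potentials := fun d hd => by
  simp only [restrict, coeff_ofCoeff]
  split_ifs with h
  · exact hg d (by rw [wt_qw]; omega)
  · rfl

/-- The solution of `y ∂_x χ = g|_{y = 0} - g`. -/
def shear (g : FormalSeries) : FormalSeries :=
  ofCoeff fun d => if d 0 = 0 then 0 else
    - coeff (d - Finsupp.single 0 1 + Finsupp.single 1 1) g / d 0

theorem coeff_shear_add (g : FormalSeries) (d : Fin 3 →₀ ℕ) :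
    coeff (d + Finsupp.single 0 1) (shear g) =
      - coeff (d + Finsupp.single 1 1) g / (d 0 + 1) := by
  simp [shear]

theorem exists_of_coeff_shear_ne_zero {g : FormalSeries} {d : Fin 3 →₀ ℕ}
    (h : coeff d (shear g) ≠ 0) :
    ∃ e, d = e + Finsupp.single 0 1 ∧ coeff (e + Finsupp.single 1 1) g ≠ 0 := by
  have h0 : d 0 ≠ 0 := fun h0 => h (by simp [shear, h0])
  obtain ⟨e, rfl⟩ : ∃ e, d = e + Finsupp.single 0 1 :=
    ⟨d - Finsupp.single 0 1, (tsub_add_cancel_of_le (by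
      rw [Finsupp.single_le_iff]; omega)).symm⟩
  refine ⟨e, rfl, fun h1 => h ?_⟩
  rw [coeff_shear_add, h1, neg_zero, zero_div]

theorem shear_mem_filt {g : FormalSeries} {n : ℕ} (hg : g ∈ filt qw (n + 1)) :
    shear g ∈ filt qw n := fun d hd => by
  by_contra h
  obtain ⟨e, rfl, he⟩ := exists_of_coeff_shear_ne_zero h
  refine he (hg _ ?_)
  rw [wt_add, wt_single] at hd ⊢
  simp only [qw_zero, qw_one] at hd ⊢
  omega

theorem pderiv_shear_mul (g : FormalSeries) : pderiv ℝ 0 (shear g) * X 1 = restrict g - g := by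
  ext d
  rw [X, coeff_mul_monomial, map_sub]
  simp only [restrict, coeff_ofCoeff]
  by_cases h : d 1 = 0
  · rw [if_neg (by rw [Finsupp.single_le_iff]; omega), if_pos h, sub_self]
  · obtain ⟨e, rfl⟩ : ∃ e, d = e + Finsupp.single 1 1 :=
      ⟨d - Finsupp.single 1 1, (tsub_add_cancel_of_le (by
        rw [Finsupp.single_le_iff]; omega)).symm⟩
    rw [if_pos le_add_self, if_neg h, add_tsub_cancel_right, coeff_pderiv, coeff_shear_add]
    have : (e 0 : ℝ) + 1 ≠ 0 := by positivity
    field_simp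
    ring

/-- The homological equation, solved at leading order. -/
theorem exists_homological {U : FormalSeries} (hU : U ∈ potentials) {m : ℕ} (hm : 5 ≤ m) :
    ∀ (j : ℕ) (g : FormalSeries), g ∈ filt qw (m + 1) →
      (∀ d, wt qw d ≤ m + 1 → j < d 1 → coeff d g = 0) →
      ∃ χ ∈ filt qw m, ∃ δ ∈ potentials, δ ∈ filt qw (m + 1) ∧
        g + lie (ham U) χ - δ ∈ filt qw (m + 2) := by
  intro j
  induction j with
  | zero =>
    intro g hg hj
    refine ⟨0, Submodule.zero_mem _, restrict g, restrict_mem_potentials (filt_mono (by omega) hg),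
      restrict_mem_filt hg, fun d hd => ?_⟩
    by_cases h : d 1 = 0
    · simp [restrict, h]
    · simp [restrict, h, hj d (by omega) (Nat.pos_of_ne_zero h)]
  | succ j ih =>
    intro g hg hj
    have hU0 : pderiv ℝ 0 U ∈ filt qw 4 := pderiv_mem_filt (by simp) (potentials_le_filt hU)
    have hs1 : pderiv ℝ 1 (shear g) ∈ filt qw (m - 3) :=
      pderiv_mem_filt (by simp) (shear_mem_filt hg)
    -- `shear g` reduces `g` to its part without `y`, at the price of −U' ∂_y (shear g). The shear
    -- and the derivative each lower the degree in `y` by one, and `U'` does not contain `y`, so the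
    -- induction hypothesis applies.
    obtain ⟨χ, hχ, δ, hδ, hδ', h⟩ := ih (- (pderiv ℝ 1 (shear g) * pderiv ℝ 0 U))
      (Submodule.neg_mem _ (filt_mono (by omega) (mul_mem_filt hs1 hU0))) (fun d hd hjd => by
        rw [map_neg, coeff_mul, neg_eq_zero]
        refine Finset.sum_eq_zero fun p hp => ?_
        rw [Finset.HasAntidiagonal.mem_antidiagonal] at hp
        rw [← hp, wt_add] at hd
        by_contra hne
        have hne1 := left_ne_zero_of_mul hne
        have hne2 := right_ne_zero_of_mul hne
        have hp2 : 4 ≤ wt qw p.2 := by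
          -- `U'` has weight at least 4, so only coefficients of `g` of weight at most m + 1 enter,
          -- where the bound on the degree in `y` is known.
          by_contra h4
          exact hne2 (hU0 _ (by omega))
        have hp21 : p.2 1 = 0 := by
          by_contra h1
          rw [coeff_pderiv, coeff_of_mem_potentials hU (by simp [h1]), zero_mul] at hne2
          exact hne2 rfl
        rw [coeff_pderiv] at hne1
        obtain ⟨e, he, hne1⟩ := exists_of_coeff_shear_ne_zero (left_ne_zero_of_mul hne1)
        have hd1 : d 1 = p.1 1 := by rw [← hp, Finsupp.add_apply, hp21, add_zero]
        have he1 : p.1 1 + 1 = e 1 := by simpa using DFunLike.congr_fun he 1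
        have hw := congrArg (wt qw) he
        simp only [wt_add, wt_single, qw_zero, qw_one] at hw
        refine hne1 (hj _ ?_ ?_)
        · simp only [wt_add, wt_single, qw_one]
          omega
        · simp only [Finsupp.add_apply, Finsupp.single_eq_same]
          omega)
    refine ⟨shear g + χ, Submodule.add_mem _ (shear_mem_filt hg) hχ, restrict g + δ,
      Submodule.add_mem _ (restrict_mem_potentials (filt_mono (by omega) hg)) hδ,
      Submodule.add_mem _ (restrict_mem_filt hg) hδ', ?_⟩
    convert h using 1
    rw [map_add, lie_ham hU (shear g), pderiv_shear_mul]
    ring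

theorem exists_homological_solution {U : FormalSeries} (hU : U ∈ potentials) {m : ℕ} (hm : 5 ≤ m)
    {g : FormalSeries} (hg : g ∈ filt qw (m + 1)) :
    ∃ χ ∈ filt qw m, ∃ δ ∈ potentials, δ ∈ filt qw (m + 1) ∧
      g + lie (ham U) χ - δ ∈ filt qw (m + 2) :=
  -- Since `y` has weight 3, a monomial of weight at most m + 1 has degree at most m + 1 in `y`.
  exists_homological hU hm (m + 1) g hg fun d hd hj => by rw [wt_qw] at hd; omega

/-- A vector field which is divergence-free at leading order is Hamiltonian at leading order. -/
theorem exists_hamiltonian {n : ℕ} {a b : FormalSeries} (ha : a ∈ filt qw (n + 2))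
    (hb : b ∈ filt qw (n + 3)) (hab : pderiv ℝ 0 a + pderiv ℝ 1 b ∈ filt qw (n + 1)) :
    ∃ g ∈ filt qw (n + 5), pderiv ℝ 1 g = a ∧ pderiv ℝ 0 g + b ∈ filt qw (n + 4) := by
  -- Integrate `a` in `y`, and choose the part without `y` by integrating −b at y = 0. Then ∂_y g =
  -- a exactly, and the divergence condition controls ∂_x g + b on the monomials divisible by `y`.
  let g : FormalSeries := ofCoeff fun d =>
    if d 1 = 0 then if d 0 = 0 then 0 else - coeff (d - Finsupp.single 0 1) b / d 0
    else coeff (d - Finsupp.single 1 1) a / d 1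
  have hg1 (d : Fin 3 →₀ ℕ) : coeff (d + Finsupp.single 1 1) g = coeff d a / (d 1 + 1) := by
    simp [g]
  have hg0 (d : Fin 3 →₀ ℕ) (h : d 1 = 0) :
      coeff (d + Finsupp.single 0 1) g = - coeff d b / (d 0 + 1) := by
    simp [g, h]
  have hpos (k : ℕ) : (k : ℝ) + 1 ≠ 0 := by positivity
  have hex {d : Fin 3 →₀ ℕ} {i : Fin 3} (h : d i ≠ 0) : ∃ e, d = e + Finsupp.single i 1 :=
    ⟨d - Finsupp.single i 1, (tsub_add_cancel_of_le (by
      rw [Finsupp.single_le_iff]; omega)).symm⟩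
  refine ⟨g, fun d hd => ?_, ?_, fun d hd => ?_⟩
  · by_cases h1 : d 1 = 0
    · by_cases h0 : d 0 = 0
      · simp [g, h1, h0]
      · obtain ⟨e, rfl⟩ := hex h0
        rw [wt_add, wt_single, qw_zero] at hd
        rw [hg0 e (by simpa using h1), hb e (by omega), neg_zero, zero_div]
    · obtain ⟨e, rfl⟩ := hex h1
      rw [wt_add, wt_single, qw_one] at hd
      rw [hg1, ha e (by omega), zero_div]
  · ext d
    rw [coeff_pderiv, hg1, div_mul_cancel₀ _ (hpos _)]
  · rw [map_add, coeff_pderiv]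
    by_cases h1 : d 1 = 0
    · rw [hg0 d h1, div_mul_cancel₀ _ (hpos _), neg_add_cancel]
    · obtain ⟨e, rfl⟩ := hex h1
      rw [wt_add, wt_single, qw_one] at hd
      have := hab e (by omega)
      rw [map_add, coeff_pderiv, coeff_pderiv] at this
      have h2 := hpos (e 1)
      rw [add_right_comm, hg1]
      simp only [Finsupp.add_apply,
        Finsupp.single_eq_of_ne (show (0 : Fin 3) ≠ 1 by decide),
        Finsupp.single_eq_of_ne (show (1 : Fin 3) ≠ 0 by decide), add_zero] at this ⊢
      field_simp
      linarith

end FormalSeries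

/-! ### The iteration and its limit. -/

namespace FormalSeries

open MvPowerSeries

/-- An endomorphism that preserves the Poisson bracket of the coordinates. -/
def IsCanonical (S : FormalSeries →ₐ[ℝ] FormalSeries) : Prop := lie (S (X 1)) (S (X 0)) = 1

theorem IsCanonical.comp {S T : FormalSeries →ₐ[ℝ] FormalSeries} (hSf : IsFiltered qw S)
    (hS : IsCanonical S) (hT : IsCanonical T) : IsCanonical (S.comp T) := by
  rw [IsCanonical, AlgHom.comp_apply, AlgHom.comp_apply, hSf.lie_map qw_pos, hT, hS, map_one,
    mul_one]

theorem isCanonical_expLie {h : FormalSeries} (hh : h ∈ filt qw 6) : IsCanonical (expLie h hh) := by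
  rw [IsCanonical, lie_expLie]
  simp

/-- The difference of two close canonical endomorphisms is Hamiltonian at leading order. -/
theorem exists_hamiltonian_of_isCanonical {P Q : FormalSeries →ₐ[ℝ] FormalSeries}
    (hP : IsUnipotent P) (hQ : IsUnipotent Q) (hPc : IsCanonical P) (hQc : IsCanonical Q) {n : ℕ}
    (h : ∀ i, P (X i) - Q (X i) ∈ filt qw (qw i + n)) :
    ∃ g ∈ filt qw (n + 5), ∀ i, P (X i) - Q (X i) - lie g (X i) ∈ filt qw (qw i + n + 1) := by
  have ha := filt_mono (show n + 2 ≤ qw 0 + n by simp; omega) (h 0)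
  have hb := filt_mono (show n + 3 ≤ qw 1 + n by simp; omega) (h 1)
  obtain ⟨g, hg, hg1, hg0⟩ := exists_hamiltonian ha hb (by
    -- With a = Px − Qx and b = Py − Qy, subtracting {Qx, Qy} = 1 from {Px, Py} = 1 gives ∂_x a +
    -- ∂_y b = −{a, Py − y} − {Qx − x, b}. Both brackets gain one weight because `P` and `Q` are
    -- unipotent.
    have e1 : lie (P (X 1) - X 1) (P (X 0) - Q (X 0)) ∈ filt qw (n + 1) :=
      lie_mem_filt (by simp; omega) (hP.sub_mem (X_mem_filt 1)) ha
    have e2 : lie (P (X 1) - Q (X 1)) (Q (X 0) - X 0) ∈ filt qw (n + 1) :=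
      lie_mem_filt (by simp) hb (hQ.sub_mem (X_mem_filt 0))
    convert Submodule.neg_mem _ (Submodule.add_mem _ e1 e2) using 1
    have e3 : lie (P (X 1)) (P (X 0)) = lie (Q (X 1)) (Q (X 0)) := by
      rw [show lie (P (X 1)) (P (X 0)) = 1 from hPc, show lie (Q (X 1)) (Q (X 0)) = 1 from hQc]
    have e4 (f : FormalSeries) : lie (X 1) f = pderiv ℝ 0 f := by simp [lie_apply]
    simp only [map_sub, LinearMap.sub_apply, e3, lie_X_zero, e4]
    ring)
  refine ⟨g, hg, fun i => ?_⟩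
  fin_cases i
  · simp [hg1]
  · simp only [Fin.mk_one, lie_X_one, sub_neg_eq_add]
    rw [add_comm (P (X 1) - Q (X 1))]
    exact filt_mono (show qw 1 + n + 1 ≤ n + 4 by simp; omega) hg0
  · simp [hP.map_eps, hQ.map_eps]

/-- The commutator of the time-one maps of `h + δ` and `χ`, at leading order. -/
theorem expOp_mul_sub_mem_raising {n : ℕ} {h χ δ : FormalSeries} (hh : h ∈ filt qw 6)
    (hχ : χ ∈ filt qw (n + 6)) (hδ : δ ∈ filt qw (n + 7)) :
    expOp (lie h) * expOp (lie χ) - expOp (lie χ) * expOp (lie (h + δ)) - lie (lie h χ - δ)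
      ∈ raising (n + 3) := by
  have hD : lie h ∈ raising 1 := lie_mem_raising hh
  have hL : lie χ ∈ raising (n + 1) := lie_mem_raising (filt_mono (by omega) hχ)
  have hM : lie δ ∈ raising (n + 2) := lie_mem_raising (filt_mono (by omega) hδ)
  set B := expOp (lie h) - 1 with hB
  set A := expOp (lie χ) - 1 with hA
  set C := expOp (lie (h + δ)) - expOp (lie h) with hC
  have hB1 : B ∈ raising 1 := expOp_sub_one_mem_raising one_pos hD
  have hA1 : A ∈ raising (n + 1) := expOp_sub_one_mem_raising (Nat.succ_pos n) hL
  have hB2 : B - lie h ∈ raising 2 := expOp_sub_one_sub_mem_raising one_pos hD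
  have hA2 : A - lie χ ∈ raising (n + 2) :=
    raising_mono (by omega) (expOp_sub_one_sub_mem_raising (Nat.succ_pos n) hL)
  have hC2 : C - lie δ ∈ raising (n + 3) := by
    have := expOp_add_sub_mem_raising hD hM (by omega)
    rwa [← map_add] at this
  have hC1 : C ∈ raising (n + 2) := by
    have := Submodule.add_mem _ (raising_mono (by omega) hC2) hM
    rwa [sub_add_cancel] at this
  have hcomm : lie (lie h χ) = lie h * lie χ - lie χ * lie h := by
    refine LinearMap.ext fun f => ?_
    simp only [LinearMap.sub_apply, Module.End.mul_apply]
    rw [lie_lie h χ f, add_sub_cancel_right]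
  -- With the three exponentials written as 1 + B, 1 + A and 1 + B + C, the difference is [B, A] − C
  -- − A C. Its leading part is [L_h, L_χ] − L_δ.
  have e : expOp (lie h) * expOp (lie χ) - expOp (lie χ) * expOp (lie (h + δ))
      - lie (lie h χ - δ) =
      (B - lie h) * A + lie h * (A - lie χ) - A * (B - lie h) - (A - lie χ) * lie h
        - (C - lie δ) - A * C := by
    have e1 : expOp (lie h) = B + 1 := by rw [hB, sub_add_cancel]
    have e2 : expOp (lie χ) = A + 1 := by rw [hA, sub_add_cancel]
    have e3 : expOp (lie (h + δ)) = C + (B + 1) := by rw [hC, ← e1, sub_add_cancel]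
    rw [e1, e2, e3, map_sub, hcomm]
    clear_value A B C
    simp only [add_mul, mul_add, sub_mul, mul_sub, one_mul, mul_one]
    abel
  rw [e]
  refine Submodule.sub_mem _ (Submodule.sub_mem _ (Submodule.sub_mem _ (Submodule.sub_mem _
    (Submodule.add_mem _ ?_ ?_) ?_) ?_) hC2) ?_
  · exact raising_mono (by omega) (mul_mem_raising hB2 hA1)
  · exact raising_mono (by omega) (mul_mem_raising hD hA2)
  · exact raising_mono (by omega) (mul_mem_raising hA1 hB2)
  · exact raising_mono (by omega) (mul_mem_raising hA2 hD)
  · exact raising_mono (by omega) (mul_mem_raising hA1 hC1)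

/-- `T` conjugates `S` to the time-one map of `y² / 2 + U` up to terms of relative weight `n + 2`. -/
structure IsConjugacyTo (S : FormalSeries →ₐ[ℝ] FormalSeries) (n : ℕ)
    (T : FormalSeries →ₐ[ℝ] FormalSeries) (U : FormalSeries) : Prop where
  isUnipotent : IsUnipotent T
  isCanonical : IsCanonical T
  mem_potentials : U ∈ potentials
  sub_mem : ∀ i, S (T (X i)) - T (expOp (lie (ham U)) (X i)) ∈ filt qw (qw i + n + 2)

/-- One step of the iteration: `g` generates the leading error, and a solution `χ`, `δ` of the
homological equation for `g` removes it. -/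
theorem IsConjugacyTo.exists_succ {S T : FormalSeries →ₐ[ℝ] FormalSeries} (hS : IsUnipotent S)
    (hSc : IsCanonical S) {n : ℕ} {U : FormalSeries} (h : IsConjugacyTo S n T U) :
    ∃ T' U', IsConjugacyTo S (n + 1) T' U' ∧
      (∀ i, T' (X i) - T (X i) ∈ filt qw (qw i + n + 1)) ∧ U' - U ∈ filt qw (n + 7) := by
  obtain ⟨hT, hTc, hU, hR⟩ := h
  have hH : ham U ∈ filt qw 6 := ham_mem_filt (potentials_le_filt hU)
  obtain ⟨g, hg, hPQ⟩ := exists_hamiltonian_of_isCanonical (P := S.comp T)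
    (Q := T.comp (expLie (ham U) hH)) (n := n + 2) (hS.comp hT)
    (hT.comp (isUnipotent_expLie hH)) (hSc.comp hS.isFiltered hTc)
    (hTc.comp hT.isFiltered (isCanonical_expLie hH)) hR
  obtain ⟨χ, hχ, δ, hδ, hδ', hsol⟩ := exists_homological_solution hU (m := n + 6) (by omega) hg
  have hχ6 : χ ∈ filt qw 6 := filt_mono (by omega) hχ
  have hEone := expOp_sub_one_mem_raising (Nat.succ_pos n)
    (lie_mem_raising (k := n + 1) (filt_mono (by omega) hχ))
  have hRz {m : ℕ} {f : FormalSeries} (hf : f ∈ filt qw m) :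
      S (T f) - T (expOp (lie (ham U)) f) ∈ filt qw (m + (n + 2)) :=
    IsFiltered.sub_mem_filt qw_pos (hS.comp hT).isFiltered
      (hT.comp (isUnipotent_expLie hH)).isFiltered (hR 0) (hR 1) hf
  refine ⟨T.comp (expLie χ hχ6), U + δ, ⟨hT.comp (isUnipotent_expLie hχ6),
    hTc.comp hT.isFiltered (isCanonical_expLie hχ6), Submodule.add_mem _ hU hδ, fun i => ?_⟩,
    fun i => ?_, by simpa using hδ'⟩
  · rw [ham_add, AlgHom.comp_apply, AlgHom.comp_apply, expLie_apply, expLie_apply]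
    set z : FormalSeries := X i
    have hz : z ∈ filt qw (qw i) := X_mem_filt i
    have hEz : expOp (lie χ) z - z ∈ filt qw (qw i + (n + 1)) := hEone _ _ hz
    set W : FormalSeries := expOp (lie (ham U)) (expOp (lie χ) z)
      - expOp (lie χ) (expOp (lie (ham U + δ)) z)
    have hW' : W - lie (lie (ham U) χ - δ) z ∈ filt qw (qw i + (n + 3)) :=
      expOp_mul_sub_mem_raising hH hχ hδ' _ _ hz
    have hW : W ∈ filt qw (qw i + (n + 2)) := by
      have h1 : lie (ham U) χ - δ ∈ filt qw (n + 7) := Submodule.sub_mem _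
        (lie_mem_filt (by omega) hH hχ) hδ'
      have := Submodule.add_mem _ (filt_mono (by omega) hW')
        (lie_mem_raising (k := n + 2) h1 _ _ hz)
      rwa [sub_add_cancel] at this
    have hTW := hT.sub_mem hW
    have h1 := hRz hEz
    have h2 : S (T z) - T (expOp (lie (ham U)) z) - lie g z ∈ filt qw (qw i + (n + 2) + 1) := hPQ i
    have h3 : lie (g + lie (ham U) χ - δ) z ∈ filt qw (qw i + (n + 3)) :=
      lie_mem_raising hsol _ _ hz
    -- Let R = S T − T exp(L_h) be the old error. The new error at `z` is R(exp(L_χ) z − z) + R z +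
    -- T W. Replacing R z by L_g z, T W by W, and W by its leading part leaves L of g + L_h χ − δ,
    -- which is small by the choice of `χ` and `δ`.
    have key := Submodule.add_mem _ (Submodule.add_mem _ (Submodule.add_mem _ (Submodule.add_mem _
      (filt_mono (show qw i + (n + 1) + 2 ≤ qw i + (n + 1) + (n + 2) by omega) h1)
      (filt_mono (by omega) h2)) (filt_mono (by omega) h3)) (filt_mono (by omega) hTW))
      (filt_mono (by omega) hW')
    convert key using 1
    simp only [W, map_sub, map_add, LinearMap.sub_apply, LinearMap.add_apply]
    abel
  · rw [AlgHom.comp_apply, expLie_apply, ← map_sub]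
    exact hT.isFiltered.map_filt (hEone _ _ (X_mem_filt i))

/-- The first approximation of a family with linear part `(x + y, y)`. -/
theorem exists_isConjugacyTo_zero {S : FormalSeries →ₐ[ℝ] FormalSeries}
    (hS : IsUnipotent S) (h0 : S (X 0) - X 0 - X 1 ∈ filt qw 4) :
    ∃ U, IsConjugacyTo S 0 (AlgHom.id ℝ _) U := by
  -- The only monomial of weight 4 is `x²`. Its coefficient `c` in S y is matched by −∂_x U with U =
  -- −c x³/3. This step is done by hand, since a generator `χ` of weight 5 would not raise weights.
  set c := coeff (Finsupp.single 0 2) (S (X 1))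
  have hV : (C (- c / 3) * X 0 ^ 3 : FormalSeries) ∈ potentials := by
    intro d hd
    rw [coeff_C_mul, coeff_X_pow, if_neg, mul_zero]
    rintro rfl
    exact hd (by simp)
  set V : FormalSeries := C (- c / 3) * X 0 ^ 3
  have hH : ham V ∈ filt qw 6 := ham_mem_filt (potentials_le_filt hV)
  have hexp (i : Fin 3) : expOp (lie (ham V)) (X i) - X i - lie (ham V) (X i) ∈
      filt qw (qw i + 2) :=
    expOp_sub_one_sub_mem_raising one_pos (lie_mem_raising (k := 1) hH) _ _ (X_mem_filt i)
  refine ⟨V, isUnipotent_id, by simp [IsCanonical], hV, fun i => ?_⟩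
  have h2 := hexp i
  fin_cases i
  · simp only [Fin.zero_eta, lie_X_zero, pderiv_one_ham hV, AlgHom.coe_id, id_eq, qw_zero] at h2 ⊢
    convert Submodule.sub_mem _ h0 h2 using 1
    abel
  · simp only [Fin.mk_one, lie_X_one, pderiv_zero_ham, AlgHom.coe_id, id_eq, qw_one] at h2 ⊢
    have h1 : S (X 1) - X 1 + pderiv ℝ 0 V ∈ filt qw 5 := by
      have hdV : pderiv ℝ 0 V = C (- c) * X 0 ^ 2 := by
        simp only [V, Derivation.leibniz, Derivation.leibniz_pow, pderiv_C, pderiv_X_self,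
          smul_eq_mul, nsmul_eq_mul, mul_zero, add_zero, mul_one]
        rw [show ((3 : ℕ) : FormalSeries) = C (3 : ℝ) from (map_ofNat C 3).symm, ← mul_assoc, ← map_mul]
        congr 2
        ring
      have h4 := hS.sub_mem (X_mem_filt (w := qw) 1)
      intro d hd
      by_cases hd4 : wt qw d < 4
      · exact Submodule.add_mem _ h4 (pderiv_mem_filt (n := 6) (by simp) (potentials_le_filt hV))
          d hd4
      · have : d = Finsupp.single 0 2 := by
          rw [wt_qw] at hd hd4
          ext j
          fin_cases j <;> simp <;> omega
        subst this
        rw [hdV, map_add, map_sub, coeff_C_mul, coeff_X_pow, if_pos rfl, coeff_X,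
          if_neg (fun h => by simpa using DFunLike.congr_fun h 1)]
        ring
    convert Submodule.sub_mem _ h1 h2 using 1
    abel
  · simp only [Fin.reduceFinMk, AlgHom.coe_id, id_eq, hS.map_eps]
    rw [expOp_eq_self (lie_X_two _)]
    simp

/-- The approximate conjugacies stabilise in every weight. The limits of T_n x and T_n y define a
pullback, and the required identities hold modulo every weight. -/
theorem exists_conjugacy {S : FormalSeries →ₐ[ℝ] FormalSeries} (hS : IsUnipotent S)
    (hSc : IsCanonical S) (h0 : S (X 0) - X 0 - X 1 ∈ filt qw 4) :
    ∃ (T : FormalSeries →ₐ[ℝ] FormalSeries) (U : FormalSeries) (hU : U ∈ potentials),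
      IsUnipotent T ∧ IsCanonical T ∧
      S.comp T = T.comp (expLie (ham U) (ham_mem_filt (potentials_le_filt hU))) := by
  obtain ⟨U₀, hU₀⟩ := exists_isConjugacyTo_zero hS h0
  choose! nextT nextU hnext using fun (n : ℕ)
    (p : (FormalSeries →ₐ[ℝ] FormalSeries) × FormalSeries) (h : IsConjugacyTo S n p.1 p.2) =>
    h.exists_succ hS hSc
  let st (n : ℕ) : (FormalSeries →ₐ[ℝ] FormalSeries) × FormalSeries :=
    Nat.rec (AlgHom.id ℝ _, U₀) (fun n p => (nextT n p, nextU n p)) n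
  have hst (n : ℕ) : IsConjugacyTo S n (st n).1 (st n).2 := by
    induction n with
    | zero => exact hU₀
    | succ n ih => exact (hnext n (st n) ih).1
  have hT (n : ℕ) (i : Fin 3) : (st (n + 1)).1 (X i) - (st n).1 (X i) ∈ filt qw (qw i + n + 1) :=
    (hnext n (st n) (hst n)).2.1 i
  have hU (n : ℕ) : (st (n + 1)).2 - (st n).2 ∈ filt qw (n + 7) :=
    (hnext n (st n) (hst n)).2.2
  obtain ⟨U, hUlim⟩ := exists_limit (w := qw) (fun n => (st n).2)
    fun n => filt_mono (by omega) (hU n)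
  choose φ hφ using fun i => exists_limit (w := qw) (fun n => (st n).1 (X i))
    fun n => filt_mono (by omega) (hT n i)
  -- The shift by 6 covers the loss of 5 in a bracket, one more for raising weights, and the weights
  -- 2 and 3 of `x` and `y`.
  have hφT (m : ℕ) (i : Fin 3) : φ i - (st (m + 6)).1 (X i) ∈ filt qw (m + 6) := hφ i (m + 6)
  have hφX (i : Fin 3) (hi : qw i ≤ 3) : φ i - X i ∈ filt qw (qw i + 1) := by
    have := Submodule.add_mem _ (filt_mono (by omega) (hφT 0 i))
      ((hst (0 + 6)).isUnipotent.sub_mem (X_mem_filt i))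
    rwa [sub_add_sub_cancel] at this
  have hφf (i : Fin 3) (hi : qw i ≤ 3) : φ i ∈ filt qw (qw i) := by
    have := Submodule.add_mem _ (filt_mono (by omega) (hφX i hi)) (X_mem_filt i)
    rwa [sub_add_cancel] at this
  let F : FormalFamily := fun i => φ i.castSucc
  have hF : F.FixesOrigin := FormalFamily.fixesOrigin_of_mem_filt qw_pos fun i =>
    hφf i.castSucc (by fin_cases i <;> simp)
  let T := F.pullback hF
  have hTf : IsFiltered qw T := FormalFamily.isFiltered_pullback hF (hφf 0 (by simp))
    (hφf 1 (by simp))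
  have hT0 : T (X 0) = φ 0 := FormalFamily.pullback_X_zero hF
  have hT1 : T (X 1) = φ 1 := FormalFamily.pullback_X_one hF
  have hTun : IsUnipotent T := hTf.isUnipotent (by rw [hT0]; exact hφX 0 (by simp))
    (by rw [hT1]; exact hφX 1 (by simp))
  have hTst (m : ℕ) (f : FormalSeries) : T f - (st (m + 6)).1 f ∈ filt qw m :=
    filt_mono (by omega) (hTf.sub_mem_filt qw_pos (hst (m + 6)).isUnipotent.isFiltered (k := m)
      (by rw [hT0]; exact filt_mono (by simp; omega) (hφT m 0))
      (by rw [hT1]; exact filt_mono (by simp; omega) (hφT m 1)) (mem_filt_zero f))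
  have hUpot : U ∈ potentials := fun d hd => by
    have h1 := hUlim (wt qw d + 1) d (Nat.lt_succ_self _)
    have h2 := coeff_of_mem_potentials (hst (wt qw d + 1)).mem_potentials hd
    rw [map_sub] at h1
    linarith
  have hH : ham U ∈ filt qw 6 := ham_mem_filt (potentials_le_filt hUpot)
  have hexp (m : ℕ) (f : FormalSeries) :
      expOp (lie (ham U)) f - expOp (lie (ham (st (m + 6)).2)) f ∈ filt qw m := by
    have hD' : lie (U - (st (m + 6)).2) ∈ raising (m + 1) := lie_mem_raising (hUlim (m + 6))
    have h1 := expOp_add_sub_mem_raising (lie_mem_raising (k := 1)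
      (ham_mem_filt (potentials_le_filt (hst (m + 6)).mem_potentials))) hD' (by omega)
    rw [← map_add, ← ham_add, add_sub_cancel] at h1
    have h2 := Submodule.add_mem _ (raising_mono (by omega) h1) hD'
    rw [sub_add_cancel] at h2
    exact filt_mono (by omega) (h2 0 f (mem_filt_zero f))
  refine ⟨T, U, hUpot, hTun, eq_of_forall_sub_mem_filt (w := qw) fun m => ?_, ?_⟩
  · have hc : lie ((st (m + 6)).1 (X 1)) ((st (m + 6)).1 (X 0)) = 1 := (hst (m + 6)).isCanonical
    rw [← hc]
    have h1 : lie (T (X 1) - (st (m + 6)).1 (X 1)) (T (X 0)) ∈ filt qw m :=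
      lie_mem_filt (m := m + 6) (n := 0) (by omega) (by rw [hT1]; exact hφT m 1) (mem_filt_zero _)
    have h2 : lie ((st (m + 6)).1 (X 1)) (T (X 0) - (st (m + 6)).1 (X 0)) ∈ filt qw m :=
      lie_mem_filt (m := 0) (n := m + 6) (by omega) (mem_filt_zero _) (by rw [hT0]; exact hφT m 0)
    convert Submodule.add_mem _ h1 h2 using 1
    simp only [map_sub, LinearMap.sub_apply]
    abel
  · have key (i : Fin 3) : S (T (X i)) = T (expOp (lie (ham U)) (X i)) := by
      refine eq_of_forall_sub_mem_filt (w := qw) fun m => ?_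
      have h1 := hS.isFiltered.map_filt (hTst m (X i))
      have h2 := filt_mono (show m ≤ _ by omega) ((hst (m + 6)).sub_mem i)
      have h3 := hTst m (expOp (lie (ham U)) (X i))
      have h4 := (hst (m + 6)).isUnipotent.isFiltered.map_filt (hexp m (X i))
      convert Submodule.sub_mem _ (Submodule.sub_mem _ (Submodule.add_mem _ h1 h2) h3) h4 using 1
      simp only [map_sub]
      abel
    exact IsFiltered.ext qw_pos (hS.isFiltered.comp hTf)
      (hTf.comp (isUnipotent_expLie hH).isFiltered) (key 0) (key 1)

end FormalSeries

/-! ### Linear parts and the real Jordan form. -/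

namespace FormalFamily

open MvPowerSeries FormalSeries

theorem jacobian_apply (F : FormalFamily) (i j : Fin 2) :
    F.jacobian i j = pderiv ℝ j.castSucc (F i) := rfl

theorem linearPart_apply (F : FormalFamily) (i j : Fin 2) :
    F.linearPart i j = coeff (Finsupp.single j.castSucc 1) (F i) := by
  rw [linearPart, Matrix.map_apply, jacobian_apply, ← coeff_zero_eq_constantCoeff_apply,
    coeff_pderiv]
  simp

theorem linearPart_comp (G : FormalFamily) {H : FormalFamily} (hH : H.FixesOrigin) :
    (G.comp H).linearPart = G.linearPart * H.linearPart := by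
  ext i j
  rw [Matrix.mul_apply, Fin.sum_univ_two]
  simp only [linearPart, Matrix.map_apply, jacobian_apply, comp_apply G hH]
  rw [hH.isFiltered.pderiv_map (fun _ => one_pos) (by fin_cases j <;> decide)]
  simp [constantCoeff_pullback]

/-- The linear map with a given matrix. -/
def linear (M : Matrix (Fin 2) (Fin 2) ℝ) : FormalFamily :=
  fun i => C (M i 0) * X 0 + C (M i 1) * X 1

theorem linear_fixesOrigin (M : Matrix (Fin 2) (Fin 2) ℝ) : (linear M).FixesOrigin := fun i => by
  simp [linear]

theorem jacobian_linear (M : Matrix (Fin 2) (Fin 2) ℝ) :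
    (linear M).jacobian = M.map (C : ℝ →+* FormalSeries) := by
  ext i j : 2
  rw [jacobian_apply, Matrix.map_apply]
  fin_cases j <;> simp [linear, Derivation.leibniz]

theorem det_jacobian_linear (M : Matrix (Fin 2) (Fin 2) ℝ) :
    (linear M).jacobian.det = C M.det := by
  rw [jacobian_linear, RingHom.map_det]
  rfl

theorem linearPart_linear (M : Matrix (Fin 2) (Fin 2) ℝ) : (linear M).linearPart = M := by
  ext i j
  simp [linearPart, jacobian_linear]

theorem linear_one : linear 1 = identity :=
  funext (Fin.forall_fin_two.2 ⟨by simp [linear, identity], by simp [linear, identity]⟩)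

theorem linear_comp (M N : Matrix (Fin 2) (Fin 2) ℝ) :
    (linear M).comp (linear N) = linear (M * N) := by
  funext i
  rw [comp_apply _ (linear_fixesOrigin N)]
  have hC (c : ℝ) : (linear N).pullback (linear_fixesOrigin N) (C c) = C c :=
    AlgHom.commutes _ c
  simp only [linear, map_add, map_mul, hC, pullback_X_zero, pullback_X_one, Matrix.mul_apply,
    Fin.sum_univ_two]
  ring

theorem constantCoeff_det_jacobian (F : FormalFamily) :
    constantCoeff F.jacobian.det = F.linearPart.det := by
  rw [linearPart, RingHom.map_det]
  rfl

end FormalFamily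

/-- A parabolic matrix is conjugate to a Jordan block by a matrix of determinant `±1`. -/
theorem IsParabolic.exists_conj {A : Matrix (Fin 2) (Fin 2) ℝ} (hA : IsParabolic A) :
    ∃ P : Matrix (Fin 2) (Fin 2) ℝ, (P.det = 1 ∨ P.det = -1) ∧ A * P = P * !![1, 1; 0, 1] := by
  obtain ⟨hchar, hdiag⟩ := hA
  have htr : A 0 0 + A 1 1 = 2 := by
    rw [← Matrix.trace_fin_two, Matrix.trace_eq_neg_charpoly_coeff, hchar]
    simp [sub_sq, Polynomial.coeff_one]
  have hdet : A 0 0 * A 1 1 - A 0 1 * A 1 0 = 1 := by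
    rw [← Matrix.det_fin_two, Matrix.det_eq_sign_charpoly_coeff, hchar]
    simp [Polynomial.coeff_zero_eq_eval_zero]
  -- Scaling a Jordan basis by `s` multiplies its determinant by `s²`, so the sign of `r` cannot be
  -- changed.
  have hsq (r : ℝ) (hr : r ≠ 0) : (√|r|)⁻¹ ^ 2 * r = 1 ∨ (√|r|)⁻¹ ^ 2 * r = -1 := by
    rw [inv_pow, Real.sq_sqrt (abs_nonneg r)]
    rcases abs_choice r with h | h <;> rw [h]
    · exact Or.inl (inv_mul_cancel₀ hr)
    · right; field_simp
  -- A − 1 is nilpotent and nonzero. The columns of `P` are (A − 1)v and v, where v is a multiple of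
  -- a basis vector that A − 1 does not kill: the first one if `A 0 1 = 0`, the second one
  -- otherwise.
  by_cases hq : A 0 1 = 0
  · have h00 : A 0 0 = 1 := by rw [hq] at hdet; nlinarith [sq_nonneg (A 0 0 - 1)]
    have h11 : A 1 1 = 1 := by linarith
    have h10 : A 1 0 ≠ 0 := fun h10 => hdiag ⟨1, fun _ => 1, by simp, by
      ext i j; fin_cases i <;> fin_cases j <;> simp [hq, h00, h11, h10]⟩
    set s := (√|A 1 0|)⁻¹
    refine ⟨!![0, s; s * A 1 0, 0], ?_, ?_⟩
    · rw [Matrix.det_fin_two_of]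
      rcases hsq _ h10 with h | h
      · right; linear_combination -h
      · left; linear_combination -h
    · ext i j
      fin_cases i <;> fin_cases j <;>
        simp [Matrix.mul_apply, Fin.sum_univ_two, hq, h00, h11, mul_comm]
  · set s := (√|A 0 1|)⁻¹
    refine ⟨!![s * A 0 1, 0; s * (A 1 1 - 1), s], ?_, ?_⟩
    · rw [Matrix.det_fin_two_of]
      rcases hsq _ hq with h | h
      · left; linear_combination h
      · right; linear_combination h
    · have e : A 0 0 = 2 - A 1 1 := by linarith
      rw [e] at hdet
      ext i j
      fin_cases i <;> fin_cases j <;> simp [Matrix.mul_apply, Fin.sum_univ_two, e] <;>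
        first | ring1 | linear_combination -s * hdet

/-! ### The normal form of formal families. -/

namespace FormalFamily

open MvPowerSeries FormalSeries

theorem isTimeOneMap_expLie {h : FormalSeries} (hh : h ∈ filt qw 6) :
    IsTimeOneMap h (ofAlgHom (expLie h hh)) := fun i d => by
  filter_upwards [Filter.eventually_gt_atTop (wt qw d)] with N hN
  rw [ofAlgHom, expLie_apply, ← coeff_expSum_eq (lie_mem_raising hh) _ hN, expSum,
    LinearMap.sum_apply]
  simp only [LinearMap.smul_apply, Module.End.pow_apply, coe_lie]

/-- The normal form of a family whose linear part is a Jordan block. -/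
theorem exists_normalForm_of_linearPart_eq {F : FormalFamily} (hF : F.FixesOrigin)
    (hdet : F.jacobian.det = 1) (hlin : F.linearPart = !![1, 1; 0, 1]) :
    ∃ (φ ψ Φ : FormalFamily) (u : ℕ → ℕ → ℝ), φ.MutuallyInverse ψ ∧ φ.jacobian.det = 1 ∧
      Φ.FixesOrigin ∧ IsTimeOneMap (normalFormHamiltonian u) Φ ∧ F = ψ.comp (Φ.comp φ) := by
  have hc (i : Fin 2) : coeff (0 : Fin 3 →₀ ℕ) (F i) = 0 := hF i
  have h00 : coeff (Finsupp.single (0 : Fin 3) 1) (F 0) = 1 := by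
    have := linearPart_apply F 0 0
    rw [hlin] at this
    exact this.symm
  have h01 : coeff (Finsupp.single (1 : Fin 3) 1) (F 0) = 1 := by
    have := linearPart_apply F 0 1
    rw [hlin] at this
    exact this.symm
  have h10 : coeff (Finsupp.single (0 : Fin 3) 1) (F 1) = 0 := by
    have := linearPart_apply F 1 0
    rw [hlin] at this
    exact this.symm
  have h11 : coeff (Finsupp.single (1 : Fin 3) 1) (F 1) = 1 := by
    have := linearPart_apply F 1 1
    rw [hlin] at this
    exact this.symm
  -- Only 1, `x` and `y` have weight below 4. Hence `F_0(0)` and `DF_0(0)` alone decide unipotence;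
  -- the terms in `ε` come later.
  have hlow (d : Fin 3 →₀ ℕ) (hd : wt qw d < 4) :
      d = 0 ∨ d = Finsupp.single 0 1 ∨ d = Finsupp.single 1 1 := by
    rw [wt_qw] at hd
    have h2 : d 2 = 0 := by omega
    have : (d 0 = 0 ∧ d 1 = 0) ∨ (d 0 = 1 ∧ d 1 = 0) ∨ (d 0 = 0 ∧ d 1 = 1) := by omega
    rcases this with h | h | h
    · left; ext i; fin_cases i <;> simp [h, h2]
    · right; left; ext i; fin_cases i <;> simp [h, h2]
    · right; right; ext i; fin_cases i <;> simp [h, h2]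
  have hX (i : Fin 3) (d : Fin 3 →₀ ℕ) : coeff d (X i : FormalSeries) =
    if d = Finsupp.single i 1 then 1 else 0 := coeff_X d i
  have hne : (Finsupp.single (0 : Fin 3) 1 : Fin 3 →₀ ℕ) ≠ Finsupp.single 1 1 := by
    simp [Finsupp.single_left_inj]
  have hne0 (i : Fin 3) : (0 : Fin 3 →₀ ℕ) ≠ Finsupp.single i 1 :=
    fun h => by simpa using DFunLike.congr_fun h i
  have hF00 : F 0 - X 0 - X 1 ∈ filt qw 4 := by
    intro d hd
    rw [map_sub, map_sub, hX, hX]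
    rcases hlow d hd with rfl | rfl | rfl
    · simp [hc, hne0]
    · simp [h00, hne]
    · simp [h01, hne.symm]
  have hF11 : F 1 - X 1 ∈ filt qw 4 := by
    intro d hd
    rw [map_sub, hX]
    rcases hlow d hd with rfl | rfl | rfl
    · simp [hc, hne0]
    · simp [h10, hne]
    · simp [h11]
  have hF03 : F 0 - X 0 ∈ filt qw 3 := by
    have := Submodule.add_mem _ (filt_mono (by norm_num) hF00) (X_mem_filt (w := qw) 1)
    rwa [sub_add_cancel] at this
  have hF0 : F 0 ∈ filt qw (qw 0) := by
    have := Submodule.add_mem _ (filt_mono (by simp) hF03) (X_mem_filt (w := qw) 0)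
    rwa [sub_add_cancel] at this
  have hF1 : F 1 ∈ filt qw (qw 1) := by
    have := Submodule.add_mem _ (filt_mono (by simp) hF11) (X_mem_filt (w := qw) 1)
    rwa [sub_add_cancel] at this
  set S := F.pullback hF
  have hSf : IsFiltered qw S := isFiltered_pullback hF hF0 hF1
  have hS : IsUnipotent S := hSf.isUnipotent (by rwa [pullback_X_zero]) (by rwa [pullback_X_one])
  have hSc : FormalSeries.IsCanonical S := by
    rw [FormalSeries.IsCanonical, pullback_X_zero, pullback_X_one, ← det_jacobian, hdet]
  obtain ⟨T, U, hU, hT, hTc, hST⟩ := exists_conjugacy hS hSc (by rwa [pullback_X_zero])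
  have hH : ham U ∈ filt qw 6 := ham_mem_filt (potentials_le_filt hU)
  obtain ⟨u, rfl⟩ := exists_eq_potential hU
  let e := AlgEquiv.ofBijective T hT.bijective
  have he (f : FormalSeries) : T (e.symm f) = f := e.apply_symm_apply f
  have he' (f : FormalSeries) : e.symm (T f) = f := e.symm_apply_apply f
  have hVf : IsFiltered qw (e.symm : FormalSeries →ₐ[ℝ] FormalSeries) := by
    refine ⟨?_, fun {n f} hf => ?_⟩
    · simpa [hT.map_eps] using he' (X 2)
    · have hm : ∀ m ≤ n, e.symm f ∈ filt qw m := by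
        intro m
        induction m with
        | zero => exact fun _ => mem_filt_zero _
        | succ m ih =>
          intro hmn
          have := Submodule.sub_mem _ (filt_mono hmn hf) (hT.sub_mem (ih (by omega)))
          rwa [he, sub_sub_cancel] at this
      exact hm n le_rfl
  have hEf := (isUnipotent_expLie hH).isFiltered
  have hφ := ofAlgHom_fixesOrigin qw_pos hT.isFiltered
  have hψ := ofAlgHom_fixesOrigin qw_pos hVf
  have hΦ := ofAlgHom_fixesOrigin qw_pos hEf
  refine ⟨ofAlgHom T, ofAlgHom (e.symm : FormalSeries →ₐ[ℝ] FormalSeries), ofAlgHom (expLie _ hH),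
    u, ⟨hφ, hψ, ?_, ?_⟩, ?_, hΦ, isTimeOneMap_expLie hH, ?_⟩
  · funext i
    rw [comp_apply _ hψ, pullback_ofAlgHom qw_pos hVf]
    exact he' _
  · funext i
    rw [comp_apply _ hφ, pullback_ofAlgHom qw_pos hT.isFiltered]
    exact he _
  · rw [det_jacobian]
    exact hTc
  -- By contravariance, S T = T exp(L_h) says φ ∘ F = Φ ∘ φ.
  · funext i
    rw [comp_apply _ (hΦ.comp hφ), pullback_comp hΦ hφ, pullback_ofAlgHom qw_pos hT.isFiltered,
      pullback_ofAlgHom qw_pos hEf, ← hST, AlgHom.comp_apply]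
    change _ = S (T (e.symm _))
    rw [he, pullback_X_castSucc]

/-- Conjugation by the linear map `P` reduces to the Jordan block; `P⁻¹` is then absorbed into `φ`,
whose determinant becomes that of `P⁻¹`. -/
theorem hasSimplifiedNormalForm {F : FormalFamily} (hdet : F.AreaPreserving) (hF : F.FixesOrigin)
    (hpar : IsParabolic F.linearPart) : HasSimplifiedNormalForm F := by
  obtain ⟨P, hP, hconj⟩ := hpar.exists_conj
  have hPu : IsUnit P.det := by rcases hP with h | h <;> simp [h]
  have hPP : P * P⁻¹ = 1 := Matrix.mul_nonsing_inv P hPu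
  have hPP' : P⁻¹ * P = 1 := Matrix.nonsing_inv_mul P hPu
  have hlin1 : F.linearPart.det = 1 := by
    have := congrArg Matrix.det hconj
    rw [Matrix.det_mul, Matrix.det_mul, Matrix.det_fin_two_of, mul_comm] at this
    simpa [hPu.ne_zero] using this
  -- The double eigenvalue 1 forces determinant 1 at the origin and so excludes −1.
  have hdet1 : F.jacobian.det = 1 := by
    refine hdet.resolve_right fun h => ?_
    have := constantCoeff_det_jacobian F
    rw [h, hlin1, map_neg, map_one] at this
    norm_num at this
  have hL := linear_fixesOrigin P
  have hL' := linear_fixesOrigin P⁻¹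
  have hdetinv : P⁻¹.det * P.det = 1 := by rw [← Matrix.det_mul, hPP', Matrix.det_one]
  obtain ⟨φ, ψ, Φ, u, ⟨hφ, hψ, hφψ, hψφ⟩, hφdet, hΦ, htime, heq⟩ :=
    exists_normalForm_of_linearPart_eq (F := (linear P⁻¹).comp (F.comp (linear P)))
      (hL'.comp (hF.comp hL))
      (by
        rw [det_jacobian_comp _ (hF.comp hL), det_jacobian_comp _ hL, det_jacobian_linear,
          det_jacobian_linear, hdet1, map_one, one_mul]
        have hC (c : ℝ) : (F.comp (linear P)).pullback (hF.comp hL) (C c) = C c :=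
          AlgHom.commutes _ c
        rw [hC, ← map_mul, hdetinv, map_one])
      (by
        rw [linearPart_comp _ (hF.comp hL), linearPart_comp _ hL, linearPart_linear,
          linearPart_linear, hconj, ← Matrix.mul_assoc, hPP', Matrix.one_mul])
  refine ⟨φ.comp (linear P⁻¹), (linear P).comp ψ, Φ, u,
    ⟨hφ.comp hL', hL.comp hψ, ?_, ?_⟩, ?_, hΦ, htime, ?_⟩
  · rw [comp_assoc _ hL' (hL.comp hψ), ← comp_assoc _ hL hψ, linear_comp, hPP', linear_one,
      identity_comp hψ, hφψ]
  · rw [comp_assoc _ hψ (hφ.comp hL'), ← comp_assoc _ hφ hL', hψφ, identity_comp hL',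
      linear_comp, hPP, linear_one]
  · rw [AreaPreserving, det_jacobian_comp _ hL', hφdet, map_one, one_mul, det_jacobian_linear]
    rcases hP with h | h <;> rw [h] at hdetinv
    · left; rw [show P⁻¹.det = 1 by linarith, map_one]
    · right; rw [show P⁻¹.det = -1 by linarith, map_neg, map_one]
  · rw [← comp_assoc _ hφ hL', comp_assoc _ hψ ((hΦ.comp hφ).comp hL'),
      ← comp_assoc _ (hΦ.comp hφ) hL', ← heq, comp_assoc _ (hF.comp hL) hL', comp_assoc _ hL hL',
      linear_comp, hPP, linear_one, comp_identity, ← comp_assoc _ hL' hF, linear_comp, hPP,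
      linear_one, identity_comp hF]

end FormalFamily

/-! ### Taylor series of smooth families. -/

section

open scoped ContDiff

theorem contDiffOn_partialDerivative {U : Set (ℝ × (Fin 2 → ℝ))} (hU : IsOpen U) (j : Fin 3)
    {f : ℝ × (Fin 2 → ℝ) → ℝ} (hf : ContDiffOn ℝ ∞ f U) :
    ContDiffOn ℝ ∞ (partialDerivative j f) U :=
  (hf.fderiv_of_isOpen hU (by simp)).clm_apply contDiffOn_const

theorem eqOn_partialDerivative {U : Set (ℝ × (Fin 2 → ℝ))} (hU : IsOpen U) (j : Fin 3)
    {f g : ℝ × (Fin 2 → ℝ) → ℝ} (h : Set.EqOn f g U) :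
    Set.EqOn (partialDerivative j f) (partialDerivative j g) U := fun p hp => by
  rw [partialDerivative, partialDerivative,
    (h.eventuallyEq_of_mem (hU.mem_nhds hp)).fderiv_eq]

theorem contDiffOn_iterate_partialDerivative {U : Set (ℝ × (Fin 2 → ℝ))} (hU : IsOpen U)
    (j : Fin 3) (n : ℕ) {f : ℝ × (Fin 2 → ℝ) → ℝ} (hf : ContDiffOn ℝ ∞ f U) :
    ContDiffOn ℝ ∞ ((partialDerivative j)^[n] f) U := by
  induction n with
  | zero => exact hf
  | succ n ih =>
    rw [Function.iterate_succ_apply']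
    exact contDiffOn_partialDerivative hU j ih

theorem eqOn_iterate_partialDerivative {U : Set (ℝ × (Fin 2 → ℝ))} (hU : IsOpen U) (j : Fin 3)
    (n : ℕ) {f g : ℝ × (Fin 2 → ℝ) → ℝ} (h : Set.EqOn f g U) :
    Set.EqOn ((partialDerivative j)^[n] f) ((partialDerivative j)^[n] g) U := by
  induction n with
  | zero => exact h
  | succ n ih =>
    rw [Function.iterate_succ_apply', Function.iterate_succ_apply']
    exact eqOn_partialDerivative hU j ih

theorem partialDerivative_comm {U : Set (ℝ × (Fin 2 → ℝ))} (hU : IsOpen U) (i j : Fin 3)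
    {f : ℝ × (Fin 2 → ℝ) → ℝ} (hf : ContDiffOn ℝ ∞ f U) :
    Set.EqOn (partialDerivative i (partialDerivative j f))
      (partialDerivative j (partialDerivative i f)) U := fun p hp => by
  have hp' := hf.contDiffAt (hU.mem_nhds hp)
  have hd : DifferentiableAt ℝ (fderiv ℝ f) p :=
    (hp'.fderiv_right (m := 1) (by norm_cast)).differentiableAt (by simp)
  have key (i j : Fin 3) : partialDerivative i (partialDerivative j f) p =
      fderiv ℝ (fderiv ℝ f) p (coordDirection i) (coordDirection j) := by
    have : partialDerivative j f = fun q => fderiv ℝ f q (coordDirection j) := rfl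
    rw [this, partialDerivative, fderiv_clm_apply hd (by fun_prop)]
    simp
  rw [key, key]
  exact (hp'.isSymmSndFDerivAt (by simp; norm_cast)).eq _ _

theorem partialDerivative_iterate_comm {U : Set (ℝ × (Fin 2 → ℝ))} (hU : IsOpen U) (i j : Fin 3)
    (n : ℕ) {f : ℝ × (Fin 2 → ℝ) → ℝ} (hf : ContDiffOn ℝ ∞ f U) :
    Set.EqOn ((partialDerivative i)^[n] (partialDerivative j f))
      (partialDerivative j ((partialDerivative i)^[n] f)) U := by
  induction n with
  | zero => exact fun _ _ => rfl
  | succ n ih =>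
    rw [Function.iterate_succ_apply', Function.iterate_succ_apply']
    exact (eqOn_partialDerivative hU i ih).trans
      (partialDerivative_comm hU i j (contDiffOn_iterate_partialDerivative hU i n hf))

theorem partialDerivative_mul {U : Set (ℝ × (Fin 2 → ℝ))} (hU : IsOpen U) (j : Fin 3)
    {f g : ℝ × (Fin 2 → ℝ) → ℝ} (hf : ContDiffOn ℝ ∞ f U) (hg : ContDiffOn ℝ ∞ g U) :
    Set.EqOn (partialDerivative j (f * g))
      (partialDerivative j f * g + f * partialDerivative j g) U := fun p hp => by
  have hf' := (hf.contDiffAt (hU.mem_nhds hp)).differentiableAt (by simp)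
  have hg' := (hg.contDiffAt (hU.mem_nhds hp)).differentiableAt (by simp)
  simp only [partialDerivative, fderiv_mul hf' hg', Pi.add_apply, Pi.mul_apply]
  simp
  ring

theorem partialDerivative_add {U : Set (ℝ × (Fin 2 → ℝ))} (hU : IsOpen U) (j : Fin 3)
    {f g : ℝ × (Fin 2 → ℝ) → ℝ} (hf : ContDiffOn ℝ ∞ f U) (hg : ContDiffOn ℝ ∞ g U) :
    Set.EqOn (partialDerivative j (f + g)) (partialDerivative j f + partialDerivative j g) U :=
  fun p hp => by
  have hf' := (hf.contDiffAt (hU.mem_nhds hp)).differentiableAt (by simp)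
  have hg' := (hg.contDiffAt (hU.mem_nhds hp)).differentiableAt (by simp)
  simp only [partialDerivative, fderiv_add hf' hg', Pi.add_apply]
  simp

open MvPowerSeries FormalSeries

theorem coeff_taylorSeriesAtOrigin (f : ℝ × (Fin 2 → ℝ) → ℝ) (d : Fin 3 →₀ ℕ) :
    coeff d (taylorSeriesAtOrigin f) =
      (partialDerivative 0)^[d 0] ((partialDerivative 1)^[d 1] ((partialDerivative 2)^[d 2] f)) 0
        / ((d 0).factorial * (d 1).factorial * (d 2).factorial : ℝ) := rfl

theorem constantCoeff_taylorSeriesAtOrigin (f : ℝ × (Fin 2 → ℝ) → ℝ) :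
    coeff 0 (taylorSeriesAtOrigin f) = f 0 := by
  rw [coeff_taylorSeriesAtOrigin]
  simp

theorem taylorSeriesAtOrigin_congr {U : Set (ℝ × (Fin 2 → ℝ))} (hU : IsOpen U) (h0 : 0 ∈ U)
    {f g : ℝ × (Fin 2 → ℝ) → ℝ} (h : Set.EqOn f g U) :
    taylorSeriesAtOrigin f = taylorSeriesAtOrigin g := by
  ext d
  rw [coeff_taylorSeriesAtOrigin, coeff_taylorSeriesAtOrigin]
  congr 1
  exact eqOn_iterate_partialDerivative hU 0 _ (eqOn_iterate_partialDerivative hU 1 _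
    (eqOn_iterate_partialDerivative hU 2 _ h)) h0

/-- Symmetry of second derivatives lets ∂_j pass the other derivatives to its place in the fixed
order; for `ε`, the innermost variable, nothing has to move. -/
theorem pderiv_taylorSeriesAtOrigin {U : Set (ℝ × (Fin 2 → ℝ))} (hU : IsOpen U) (h0 : 0 ∈ U)
    (j : Fin 3) {f : ℝ × (Fin 2 → ℝ) → ℝ} (hf : ContDiffOn ℝ ∞ f U) :
    pderiv ℝ j (taylorSeriesAtOrigin f) = taylorSeriesAtOrigin (partialDerivative j f) := by
  ext d
  have hf2 := contDiffOn_iterate_partialDerivative hU 2 (d 2) hf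
  have e2 := partialDerivative_iterate_comm hU 2 j (d 2) hf
  have e1 := (eqOn_iterate_partialDerivative hU 1 (d 1) e2).trans
    (partialDerivative_iterate_comm hU 1 j (d 1) hf2)
  rw [coeff_pderiv, coeff_taylorSeriesAtOrigin, coeff_taylorSeriesAtOrigin]
  have hfac (n : ℕ) : (n.factorial : ℝ) ≠ 0 := by positivity
  have hpos (n : ℕ) : (n : ℝ) + 1 ≠ 0 := by positivity
  have hd := hpos (d j)
  have := hfac (d 0)
  have := hfac (d 1)
  have := hfac (d 2)
  fin_cases j
  · have e : (partialDerivative 0)^[d 0] (partialDerivative 0 ((partialDerivative 1)^[d 1]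
        ((partialDerivative 2)^[d 2] f))) 0 = (partialDerivative 0)^[d 0] ((partialDerivative 1)^[d 1]
        ((partialDerivative 2)^[d 2] (partialDerivative 0 f))) 0 :=
      (eqOn_iterate_partialDerivative hU 0 (d 0) e1 h0).symm
    simp [e, Nat.factorial_succ] at hd ⊢
    field_simp
  · have e : (partialDerivative 0)^[d 0] ((partialDerivative 1)^[d 1]
        (partialDerivative 1 ((partialDerivative 2)^[d 2] f))) 0 = (partialDerivative 0)^[d 0]
        ((partialDerivative 1)^[d 1] ((partialDerivative 2)^[d 2] (partialDerivative 1 f))) 0 :=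
      (eqOn_iterate_partialDerivative hU 0 (d 0)
        (eqOn_iterate_partialDerivative hU 1 (d 1) e2) h0).symm
    simp [e, Nat.factorial_succ] at hd ⊢
    field_simp
  · simp [Nat.factorial_succ] at hd ⊢
    field_simp

/-- An identity of Taylor series can be proved by differentiating. -/
theorem coeff_add_single_eq {f g : FormalSeries} {d : Fin 3 →₀ ℕ} {j : Fin 3}
    (h : coeff d (pderiv ℝ j f) = coeff d (pderiv ℝ j g)) :
    coeff (d + Finsupp.single j 1) f = coeff (d + Finsupp.single j 1) g := by
  rw [coeff_pderiv, coeff_pderiv] at h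
  exact mul_right_cancel₀ (by positivity) h

theorem exponent_induction {p : (Fin 3 →₀ ℕ) → Prop} (h0 : p 0)
    (h : ∀ d j, p d → p (d + Finsupp.single j 1)) (d : Fin 3 →₀ ℕ) : p d := by
  induction hn : wt (fun _ => 1) d generalizing d with
  | zero =>
    have : d = 0 := by
      ext i
      have := le_wt (w := fun _ => 1) (fun _ => one_pos) d i
      simp only [Finsupp.coe_zero, Pi.zero_apply]
      omega
    rwa [this]
  | succ n ih =>
    obtain ⟨j, hj⟩ : ∃ j, d j ≠ 0 := by
      by_contra! hd
      simp [wt, hd] at hn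
    obtain ⟨e, rfl⟩ : ∃ e, d = e + Finsupp.single j 1 :=
      ⟨d - Finsupp.single j 1, (tsub_add_cancel_of_le (by
        rw [Finsupp.single_le_iff]; omega)).symm⟩
    rw [wt_add, wt_single] at hn
    exact h e j (ih e (by omega))

theorem taylorSeriesAtOrigin_add {U : Set (ℝ × (Fin 2 → ℝ))} (hU : IsOpen U) (h0 : 0 ∈ U)
    {f g : ℝ × (Fin 2 → ℝ) → ℝ} (hf : ContDiffOn ℝ ∞ f U) (hg : ContDiffOn ℝ ∞ g U) :
    taylorSeriesAtOrigin (f + g) = taylorSeriesAtOrigin f + taylorSeriesAtOrigin g := by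
  ext d
  induction d using exponent_induction generalizing f g with
  | h0 => simp only [map_add, constantCoeff_taylorSeriesAtOrigin, Pi.add_apply]
  | h d j ih =>
    refine coeff_add_single_eq ?_
    rw [map_add, pderiv_taylorSeriesAtOrigin hU h0 j hf, pderiv_taylorSeriesAtOrigin hU h0 j hg,
      pderiv_taylorSeriesAtOrigin hU h0 j (f := f + g) (hf.add hg),
      taylorSeriesAtOrigin_congr hU h0 (partialDerivative_add hU j hf hg)]
    exact ih (contDiffOn_partialDerivative hU j hf) (contDiffOn_partialDerivative hU j hg)

/-- Both sides satisfy the Leibniz rule and agree at the origin, so induction on the exponent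
replaces a multinomial formula. -/
theorem taylorSeriesAtOrigin_mul {U : Set (ℝ × (Fin 2 → ℝ))} (hU : IsOpen U) (h0 : 0 ∈ U)
    {f g : ℝ × (Fin 2 → ℝ) → ℝ} (hf : ContDiffOn ℝ ∞ f U) (hg : ContDiffOn ℝ ∞ g U) :
    taylorSeriesAtOrigin (f * g) = taylorSeriesAtOrigin f * taylorSeriesAtOrigin g := by
  ext d
  induction d using exponent_induction generalizing f g with
  | h0 =>
    rw [coeff_zero_eq_constantCoeff_apply, coeff_zero_eq_constantCoeff_apply, map_mul]
    simp only [← coeff_zero_eq_constantCoeff_apply]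
    simp only [constantCoeff_taylorSeriesAtOrigin, Pi.mul_apply]
  | h d j ih =>
    refine coeff_add_single_eq ?_
    have hf' := contDiffOn_partialDerivative hU j hf
    have hg' := contDiffOn_partialDerivative hU j hg
    rw [Derivation.leibniz, pderiv_taylorSeriesAtOrigin hU h0 j hf,
      pderiv_taylorSeriesAtOrigin hU h0 j hg,
      pderiv_taylorSeriesAtOrigin hU h0 j (f := f * g) (hf.mul hg),
      taylorSeriesAtOrigin_congr hU h0 (partialDerivative_mul hU j hf hg),
      taylorSeriesAtOrigin_add hU h0 (f := partialDerivative j f * g)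
        (g := f * partialDerivative j g) (hf'.mul hg) (hf.mul hg'), map_add, ih hf' hg, ih hf hg',
      ← map_add, smul_eq_mul, smul_eq_mul, add_comm, mul_comm (taylorSeriesAtOrigin g)]

theorem taylorSeriesAtOrigin_const (c : ℝ) : taylorSeriesAtOrigin (fun _ => c) = C c := by
  ext d
  induction d using exponent_induction generalizing c with
  | h0 => simp [constantCoeff_taylorSeriesAtOrigin]
  | h d j ih =>
    refine coeff_add_single_eq ?_
    have e : partialDerivative j (fun _ => c) = fun _ => 0 := by
      funext p
      simp [partialDerivative]
    rw [pderiv_taylorSeriesAtOrigin isOpen_univ (Set.mem_univ _) j contDiffOn_const, e, ih 0,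
      pderiv_C, map_zero]

namespace FormalFamily

theorem planeJacobian_apply {F : ℝ → (Fin 2 → ℝ) → (Fin 2 → ℝ)} {p : ℝ × (Fin 2 → ℝ)}
    (hF : DifferentiableAt ℝ (fun q : ℝ × (Fin 2 → ℝ) => F q.1 q.2) p) (i j : Fin 2) :
    planeJacobian (F p.1) p.2 i j = partialDerivative j.castSucc (fun q => F q.1 q.2 i) p := by
  have h1 : HasFDerivAt (F p.1) ((fderiv ℝ (fun q : ℝ × (Fin 2 → ℝ) => F q.1 q.2) p).comp
      (ContinuousLinearMap.inr ℝ ℝ (Fin 2 → ℝ))) p.2 :=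
    HasFDerivAt.comp p.2 (g := fun q : ℝ × (Fin 2 → ℝ) => F q.1 q.2) (f := fun z => (p.1, z))
      hF.hasFDerivAt (hasFDerivAt_prodMk_right p.1 p.2)
  have h2 := (hasFDerivAt_pi'.1 hF.hasFDerivAt i).fderiv
  rw [planeJacobian, LinearMap.toMatrix'_apply, h1.fderiv, partialDerivative, h2]
  have e : coordDirection j.castSucc = (0, Pi.single j 1) := by fin_cases j <;> rfl
  simp [e]

theorem hasSimplifiedNormalForm_taylorFamily {F : ℝ → (Fin 2 → ℝ) → (Fin 2 → ℝ)}
    {U : Set (ℝ × (Fin 2 → ℝ))} (hU : IsOpen U) (h0 : (0, 0) ∈ U)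
    (hF : ContDiffOn ℝ ∞ (fun p : ℝ × (Fin 2 → ℝ) => F p.1 p.2) U)
    (hdet : ∀ p ∈ U, |(planeJacobian (F p.1) p.2).det| = 1) (hfix : F 0 0 = 0)
    (hpar : IsParabolic (planeJacobian (F 0) 0)) :
    HasSimplifiedNormalForm (taylorFamily F) := by
  set f : Fin 2 → ℝ × (Fin 2 → ℝ) → ℝ := fun i p => F p.1 p.2 i
  have hf (i : Fin 2) : ContDiffOn ℝ ∞ (f i) U := contDiffOn_pi.1 hF i
  have hJ (p : ℝ × (Fin 2 → ℝ)) (hp : p ∈ U) (i j : Fin 2) :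
      planeJacobian (F p.1) p.2 i j = partialDerivative j.castSucc (f i) p :=
    planeJacobian_apply ((hF.contDiffAt (hU.mem_nhds hp)).differentiableAt (by simp)) i j
  let D : ℝ × (Fin 2 → ℝ) → ℝ := fun p =>
    partialDerivative 0 (f 0) p * partialDerivative 1 (f 1) p -
      partialDerivative 1 (f 0) p * partialDerivative 0 (f 1) p
  have hD (p : ℝ × (Fin 2 → ℝ)) (hp : p ∈ U) : |D p| = 1 := by
    rw [← hdet p hp, Matrix.det_fin_two, hJ p hp, hJ p hp, hJ p hp, hJ p hp]
    rfl
  have hpd (i : Fin 2) (j : Fin 3) : ContDiffOn ℝ ∞ (partialDerivative j (f i)) U :=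
    contDiffOn_partialDerivative hU j (hf i)
  have hDc : ContinuousOn D U :=
    ((hpd 0 0).continuousOn.mul (hpd 1 1).continuousOn).sub
      ((hpd 0 1).continuousOn.mul (hpd 1 0).continuousOn)
  set s := D (0, 0)
  have hs : s = 1 ∨ s = -1 := eq_or_eq_neg_of_abs_eq (hD _ h0)
  -- `U` need not be connected, so the sign of the determinant is fixed only near the origin: on `V`
  -- the value −s is out of reach.
  let V := U ∩ D ⁻¹' Set.Ioo (s - 1) (s + 1)
  have hV : IsOpen V := hDc.isOpen_inter_preimage hU isOpen_Ioo
  have h0V : (0, 0) ∈ V := ⟨h0, by simp [s]⟩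
  have hVU : V ⊆ U := Set.inter_subset_left
  have hDV (p : ℝ × (Fin 2 → ℝ)) (hp : p ∈ V) : D p = s := by
    have h2 : s - 1 < D p ∧ D p < s + 1 := hp.2
    rcases eq_or_eq_neg_of_abs_eq (hD p hp.1) with h | h <;> rcases hs with h' | h' <;>
      rw [h, h'] at h2 ⊢ <;> norm_num at h2
  have hpdV (i : Fin 2) (j : Fin 3) : ContDiffOn ℝ ∞ (partialDerivative j (f i)) V :=
    (hpd i j).mono hVU
  have hT (i : Fin 2) (j : Fin 3) : pderiv ℝ j (taylorFamily F i) =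
      taylorSeriesAtOrigin (partialDerivative j (f i)) :=
    pderiv_taylorSeriesAtOrigin hU h0 j (hf i)
  refine hasSimplifiedNormalForm ?_ (fun i => ?_) ?_
  · have h1 : taylorSeriesAtOrigin (partialDerivative 0 (f 0) * partialDerivative 1 (f 1)) =
        taylorSeriesAtOrigin ((fun _ => s) + partialDerivative 1 (f 0) * partialDerivative 0 (f 1)) :=
      taylorSeriesAtOrigin_congr hV h0V fun p hp => by
        simp only [Pi.mul_apply, Pi.add_apply]
        linarith [hDV p hp]
    rw [taylorSeriesAtOrigin_add hV h0V (f := fun _ => s)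
        (g := partialDerivative 1 (f 0) * partialDerivative 0 (f 1)) contDiffOn_const
        ((hpdV 0 1).mul (hpdV 1 0)),
      taylorSeriesAtOrigin_mul hV h0V (hpdV 0 0) (hpdV 1 1),
      taylorSeriesAtOrigin_mul hV h0V (hpdV 0 1) (hpdV 1 0), taylorSeriesAtOrigin_const,
      ← hT, ← hT, ← hT, ← hT] at h1
    have h2 : (taylorFamily F).jacobian.det = C s := by
      rw [det_jacobian, lie_apply, h1, add_sub_cancel_right]
    rw [AreaPreserving, h2]
    rcases hs with h | h
    · left; rw [h, map_one]
    · right; rw [h, map_neg, map_one]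
  · rw [← coeff_zero_eq_constantCoeff_apply]
    refine (constantCoeff_taylorSeriesAtOrigin _).trans ?_
    simp [hfix]
  · convert hpar using 1
    ext i j
    rw [linearPart, Matrix.map_apply, jacobian_apply, hT, ← coeff_zero_eq_constantCoeff_apply,
      constantCoeff_taylorSeriesAtOrigin]
    exact (hJ (0, 0) h0 i j).symm

end FormalFamily

end

end

theorem theorem1 :
    -- formal families
    (∀ F : FormalFamily, F.AreaPreserving → F.FixesOrigin → IsParabolic F.linearPart →
      HasSimplifiedNormalForm F) ∧
    -- smooth families, defined for `(ε, (x, y))` in an open neighbourhood of the origin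
    (∀ (F : ℝ → (Fin 2 → ℝ) → (Fin 2 → ℝ)) (U : Set (ℝ × (Fin 2 → ℝ))),
      IsOpen U → (0, 0) ∈ U →
      ContDiffOn ℝ (⊤ : ℕ∞) (fun p : ℝ × (Fin 2 → ℝ) => F p.1 p.2) U →
      (∀ p ∈ U, |(planeJacobian (F p.1) p.2).det| = 1) →
      F 0 0 = 0 → IsParabolic (planeJacobian (F 0) 0) →
      HasSimplifiedNormalForm (taylorFamily F)) ∧
    -- analytic families
    (∀ (F : ℝ → (Fin 2 → ℝ) → (Fin 2 → ℝ)) (U : Set (ℝ × (Fin 2 → ℝ))),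
      IsOpen U → (0, 0) ∈ U →
      AnalyticOnNhd ℝ (fun p : ℝ × (Fin 2 → ℝ) => F p.1 p.2) U →
      (∀ p ∈ U, |(planeJacobian (F p.1) p.2).det| = 1) →
      F 0 0 = 0 → IsParabolic (planeJacobian (F 0) 0) →
      HasSimplifiedNormalForm (taylorFamily F)) := by
  refine ⟨fun _ h₁ h₂ h₃ => FormalFamily.hasSimplifiedNormalForm h₁ h₂ h₃,
    fun _ _ hU h0 hF => FormalFamily.hasSimplifiedNormalForm_taylorFamily hU h0 hF,
    fun _ _ hU h0 hF => FormalFamily.hasSimplifiedNormalForm_taylorFamily hU h0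
      (hF.contDiffOn hU.uniqueDiffOn)⟩
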